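/- **Setting.** Let $G=(V,E)$ be a finite undirected graph with maximum degree $\Delta$, and let $0<\varepsilon<1$. Write $\log=\log_2$, with $\log\Delta$ read as $0$ if $\Delta=0$. Let $I=\lceil 2000(\ln 1500+\ln(2/\varepsilon))\rceil$ and $R=\lceil 104000(\log\Delta+\log(2/\varepsilon))\rceil$. **Algorithm.** Every node $v$ keeps a desire-level $p(v)$, initially $1/2$. The algorithm runs for $R$ rounds of $2I+1$ slots each. In every slot a node that has not terminated either beeps or listens, and a listening node only learns whether at least one neighbor beeps. * In the first $I$ slots of a round, $v$ beeps in each slot independently with probability $p(v)$. It counts the number $c$ of slots in which it listens and the number $b$ of those in which it hears a beep. * At the start of the next $I$ slots, $v$ is marked with probability $p(v)$. If marked, it beeps in a uniformly random set of $\lfloor I/2\rfloor$ of these slots and listens in the others. If it is marked and hears no beep, it outputs IN at the end of these slots. * In the last slot of the round, $v$ beeps if it has output IN. A node that beeps in this slot terminates, and any other node that hears a beep in it outputs OUT and terminates. Every remaining node replaces $p(v)$ by $p(v)/2$ if its estimate is "high" and by $\min\{2p(v),1/2\}$ otherwise. The estimate is "high" if $b/c>1/5$ when $c>I/3$, and is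 decided by a fair coin when $c\le I/3$. **Execution.** The algorithm is executed on an abstract MAC layer with aborts, in discrete time, with these guarantees: * a node receives a message only while a neighbor is broadcasting it; * a broadcast is acknowledged only when all neighbors of the sender have received it; * a broadcast that is not aborted is acknowledged within $f_{ack}$ time; * (progress bound) if a neighbor of $v$ is broadcasting throughout $f_{prog}\ge 1$ consecutive time steps, then $v$ receives some message during them. Slot $t=1,2,\dots$ is emulated in the time steps $(t-1)f_{prog}+1,\dots,t f_{prog}$. A node that beeps in slot $t$ starts broadcasting "beep" at time $(t-1)f_{prog}+1$ and aborts at time $t f_{prog}$. A node hears a beep in slot $t$ if it receives a message in these time steps. **Local correctness.** The decision of $v$ is *locally correct* if the following hold: an output of $v$ is never revised; if $v$ outputs IN, then at that moment no neighbor is IN and no neighbor outputs IN later; if $v$ outputs OUT, then at that moment some neighbor is already IN. **Theorem.** There is a universal constant $K>0$ such that the following holds for all $G$, $\varepsilon$, $f_{prog}$, $f_{ack}$, every behavior of the MAC layer and every node $v$. Let $N_2^+(v)$ be the set of nodes at hop-distance at most $2$ from $v$. Suppose the coin tosses of the nodes in $N_2^+(v)$ are random, while those of all other nodes are determined by an arbitrary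 adversary who may use all coins tossed up to and including the current round (in particular, they may also be random). 1. When $v$ terminates, it has made its decision (output IN or OUT). This decision is locally correct, with the only possible exception that $v$ and a neighbor of $v$ output IN at exactly the same moment. 2. With probability at least $1-\varepsilon$, node $v$ terminates within time $K(\log\Delta+\log(2/\varepsilon))\cdot\log(2/\varepsilon)\cdot f_{prog}$ and its decision is locally correct. If $\varepsilon\le 1/2$, the same holds with the time bound $K(\log\Delta+\log(1/\varepsilon))\cdot\log(1/\varepsilon)\cdot f_{prog}$. -/

import Mathlib

namespace BeepMIS

/-! ### Abstract MAC layer with aborts, in discrete time -/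

/-- A trace of events at the interface between the nodes and a MAC layer. Time is discrete.
Within one time step, broadcasts are submitted first, then messages are delivered, then
broadcasts are ended by an acknowledgment or an abort. -/
structure Trace (V M : Type*) where
  /-- `bcst τ u m`: at time `τ` node `u` submits message `m` for broadcast. -/
  bcst : ℕ → V → M → Prop
  /-- `abort τ u`: at time `τ` node `u` aborts its broadcast in progress, if any. -/
  abort : ℕ → V → Prop
  /-- `rcv τ v u m`: at time `τ` node `v` receives the message `m` broadcast by `u`
  (the node itself only sees `m`). -/
  rcv : ℕ → V → V → M → Prop
  /-- `ack τ u m`: at time `τ` the layer acknowledges to `u` its broadcast of `m`. -/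
  ack : ℕ → V → M → Prop

/-- Node `u` submitted `m` at time `s` and is still broadcasting it at time `τ`
(it may be acknowledged or aborted at the end of time step `τ`, but not earlier). -/
def Trace.ActiveSince {V M : Type*} (α : Trace V M) (s τ : ℕ) (u : V) (m : M) : Prop :=
  s ≤ τ ∧ α.bcst s u m ∧ ∀ r, s ≤ r → r < τ → ¬ α.abort r u ∧ ¬ α.ack r u m

/-- The guarantees of an abstract MAC layer with aborts on the network `G`, with progress bound
`fprog` and acknowledgment bound `fack`. -/
structure IsMACLayer {V M : Type*} (G : SimpleGraph V) (fprog fack : ℕ) (α : Trace V M) :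
    Prop where
  /-- Only messages that a neighbor is currently broadcasting are received. -/
  rcv_correct : ∀ τ v u m, α.rcv τ v u m → G.Adj u v ∧ ∃ s, α.ActiveSince s τ u m
  /-- A broadcast is acknowledged only while in progress, and only once all neighbors of the
  sender have received its message. -/
  ack_correct : ∀ τ u m, α.ack τ u m → ∃ s, α.ActiveSince s τ u m ∧
    ∀ v, G.Adj u v → ∃ r, s ≤ r ∧ r ≤ τ ∧ α.rcv r v u m
  /-- Acknowledgment bound: unless aborted before, a broadcast is acknowledged within `fack`. -/
  ack_bound : ∀ s u m, α.bcst s u m → ∃ r, s ≤ r ∧ r < s + fack ∧ (α.ack r u m ∨ α.abort r u)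
  /-- Progress bound: if `u` is broadcasting throughout the `fprog` time steps
  `a, …, a + fprog - 1`, then each neighbor `v` of `u` receives some message in them. -/
  progress : ∀ u v, G.Adj u v → ∀ a m, (∃ s ≤ a, α.ActiveSince s (a + fprog - 1) u m) →
    ∃ r, a ≤ r ∧ r < a + fprog ∧ ∃ w m', α.rcv r v w m'

/-! ### Coin tosses -/

/-- The coin tosses of one node in one round, when an interval has `I` slots and there are `R`
rounds: a number for each slot of the first interval (does the node beep?), a bit (how to
decide if the node hardly listened), a number (does it get marked?), and a set of half of the
slots of the second interval. All of them are uniform and independent. -/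
abbrev RoundCoins (I R : ℕ) : Type :=
  (Fin I → Fin (2 ^ R)) × Bool × Fin (2 ^ R) × {S : Finset (Fin I) // S.card = I / 2}

/-- All coin tosses of all nodes in all rounds. -/
abbrev Coins (V : Type*) (I R : ℕ) : Type _ := V → Fin R → RoundCoins I R

instance (I R : ℕ) : Nonempty (RoundCoins I R) := by
  obtain ⟨S, -, hS⟩ := Finset.exists_subset_card_eq
    (s := (Finset.univ : Finset (Fin I))) (n := I / 2)
    (by rw [Finset.card_univ, Fintype.card_fin]; exact Nat.div_le_self I 2)
  exact ⟨⟨fun _ => ⟨0, by positivity⟩, true, ⟨0, by positivity⟩, ⟨S, hS⟩⟩⟩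

/-- An event of probability `p`, from a uniform `U ∈ {0, …, 2 ^ R - 1}`: the probability is
exactly `p` if `p` is one of `1/2, 1/4, …, 1/2 ^ R`. -/
def hits {R : ℕ} (U : Fin (2 ^ R)) (p : ℚ) : Bool := decide (((U : ℕ) : ℚ) / 2 ^ R < p)

/-! ### The algorithm of a single node, slot by slot -/

/-- The possible outputs of a node. -/
inductive Decision
  | IN
  | OUT
  deriving DecidableEq

/-- The local state of a node. -/
structure NodeState where
  /-- the desire-level `p_t` of the current round -/
  p : ℚ
  /-- number of slots of the first interval of the round in which the node listened -/
  c : ℕ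
  /-- number of beeps received in those slots -/
  b : ℕ
  /-- has the node been marked and received a beep in the second interval of the round? -/
  disturbed : Bool
  /-- the output, if already made -/
  output : Option Decision
  /-- has the node been removed? -/
  terminated : Bool

/-- The state in which all nodes wake up. -/
def NodeState.init : NodeState := ⟨1 / 2, 0, 0, false, none, false⟩

/-- Is the node marked in this round? -/
def marked {I R : ℕ} (ω : RoundCoins I R) (s : NodeState) : Bool := hits ω.2.2.1 s.p

/-- Does the node beep in slot `i` of the round? The slots `0 ≤ i < I` are the first interval,
`I ≤ i < 2 * I` the second one, and `i = 2 * I` is the final slot. -/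
def beeps {I R : ℕ} (ω : RoundCoins I R) (i : ℕ) (s : NodeState) : Bool :=
  if s.terminated then false
  else if h : i < I then hits (ω.1 ⟨i, h⟩) s.p
  else if h : i - I < I then marked ω s && decide ((⟨i - I, h⟩ : Fin I) ∈ ω.2.2.2.1)
  else decide (s.output = some Decision.IN)

/-- The estimate whether the effective degree is high: `b / c > 1 / 5` if the node listened in
more than `I / 3` slots, and a fair coin otherwise. -/
def estimateHigh {I R : ℕ} (ω : RoundCoins I R) (s : NodeState) : Bool :=
  if (s.c : ℚ) ≤ (I : ℚ) / 3 then ω.2.1 else decide ((s.b : ℚ) / s.c > 1 / 5)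

/-- The desire-level of the next round. -/
def nextDesire {I R : ℕ} (ω : RoundCoins I R) (s : NodeState) : ℚ :=
  if estimateHigh ω s then s.p / 2 else min (2 * s.p) (1 / 2)

/-- The state after slot `i` of the round; `heard` tells whether some beep arrived in this slot
(it is ignored when the node itself beeps). -/
def step {I R : ℕ} (ω : RoundCoins I R) (i : ℕ) (s : NodeState) (heard : Bool) : NodeState :=
  if s.terminated then s
  else if i < I then
    if beeps ω i s then s
    else { s with c := s.c + 1, b := if heard then s.b + 1 else s.b }
  else if i < 2 * I then
    let d : Bool := s.disturbed || (marked ω s && !(beeps ω i s) && heard)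
    { s with
      disturbed := d
      output := if i + 1 = 2 * I ∧ marked ω s = true ∧ d = false then some Decision.IN
        else s.output }
  else
    if s.output = some Decision.IN then { s with terminated := true }
    else if heard then { s with output := some Decision.OUT, terminated := true }
    else { s with p := nextDesire ω s, c := 0, b := 0, disturbed := false }

/-! ### Running the algorithm on the MAC layer

Slot `n = 0, 1, 2, …` of the beeping algorithm takes the time steps
`n * f + 1, …, (n + 1) * f`. It is slot `n % (2 * I + 1)` of round `n / (2 * I + 1)`. -/

/-- The only message. -/
inductive Message
  | beep

/-- Node `v` receives a message during slot `n`. -/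
def Hears {V : Type*} (f : ℕ) (α : Trace V Message) (n : ℕ) (v : V) : Prop :=
  ∃ τ, n * f + 1 ≤ τ ∧ τ ≤ (n + 1) * f ∧ ∃ u, α.rcv τ v u Message.beep

open Classical in
/-- The state of node `v` after the first `n` slots, when its coins are `ω` and the events at
the interface to the MAC layer are `α`. The algorithm runs for `R` rounds. -/
noncomputable def nodeState {V : Type*} {I R : ℕ} (f : ℕ) (ω : Fin R → RoundCoins I R)
    (α : Trace V Message) (v : V) : ℕ → NodeState
  | 0 => NodeState.init
  | n + 1 =>
    if h : n / (2 * I + 1) < R then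
      step (ω ⟨n / (2 * I + 1), h⟩) (n % (2 * I + 1)) (nodeState f ω α v n)
        (decide (Hears f α n v))
    else nodeState f ω α v n

/-- Node `v` wants to beep in slot `n`. -/
def WantsBeep {V : Type*} {I R : ℕ} (f : ℕ) (ω : Fin R → RoundCoins I R)
    (α : Trace V Message) (v : V) (n : ℕ) : Prop :=
  ∃ h : n / (2 * I + 1) < R,
    beeps (ω ⟨n / (2 * I + 1), h⟩) (n % (2 * I + 1)) (nodeState f ω α v n) = true

/-- `α` is an execution, with coin tosses `ω`, of the algorithm on an abstract MAC layer with
aborts: a node that wants to beep in slot `n` broadcasts "beep" at time `n * fprog + 1` and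
aborts at time `(n + 1) * fprog`. -/
structure IsExecution {V : Type*} {I R : ℕ} (G : SimpleGraph V) (fprog fack : ℕ)
    (ω : Coins V I R) (α : Trace V Message) : Prop where
  mac : IsMACLayer G fprog fack α
  bcst_iff : ∀ τ v m, α.bcst τ v m ↔ ∃ n, τ = n * fprog + 1 ∧ WantsBeep fprog (ω v) α v n
  abort_iff : ∀ τ v, α.abort τ v ↔ ∃ n, τ = (n + 1) * fprog ∧ WantsBeep fprog (ω v) α v n

/-- The output of node `v` at time `τ`, if already made. -/
noncomputable def outputAt {V : Type*} {I R : ℕ} (f : ℕ) (ω : Coins V I R)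
    (α : Trace V Message) (v : V) (τ : ℕ) : Option Decision :=
  (nodeState f (ω v) α v (τ / f)).output

/-- Node `v` has terminated by time `τ`. -/
def TerminatedAt {V : Type*} {I R : ℕ} (f : ℕ) (ω : Coins V I R)
    (α : Trace V Message) (v : V) (τ : ℕ) : Prop :=
  (nodeState f (ω v) α v (τ / f)).terminated = true

/-! ### Local correctness -/

/-- Node `v` makes the output `d` at time `τ`. -/
def MakesOutput {V : Type*} (out : V → ℕ → Option Decision) (v : V) (d : Decision) (τ : ℕ) :
    Prop :=
  out v τ = some d ∧ ∀ σ < τ, out v σ = none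

/-- Local correctness at the node `v`, of outputs over time. -/
structure LocallyCorrect {V : Type*} (G : SimpleGraph V) (out : V → ℕ → Option Decision)
    (v : V) : Prop where
  /-- An output is not revised. -/
  irrevocable : ∀ d τ σ, τ ≤ σ → out v τ = some d → out v σ = some d
  /-- When `v` outputs `IN`, no neighbor is `IN` and none will output `IN` later. -/
  of_in : ∀ τ, MakesOutput out v Decision.IN τ → ∀ u, G.Adj v u →
    out u τ ≠ some Decision.IN ∧ ∀ σ, τ < σ → ¬ MakesOutput out u Decision.IN σ
  /-- When `v` outputs `OUT`, some neighbor is already `IN`. -/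
  of_out : ∀ τ, MakesOutput out v Decision.OUT τ → ∃ u, G.Adj v u ∧ out u τ = some Decision.IN

/-! ### Adversarial coin tosses -/

/-- The coin tosses in the 2-hop neighborhood of `v` (including `v`) are the random ones, and
those of all other nodes are determined by an adversary, who may use everything tossed up to and
including the current round. (The adversary may leave all of them as they are.) -/
structure IsAdversary {V : Type*} {I R : ℕ} (G : SimpleGraph V) (v : V)
    (adv : Coins V I R → Coins V I R) : Prop where
  inside : ∀ ω u, G.edist v u ≤ 2 → adv ω u = ω u
  nonanticipating : ∀ ω ω' (t : Fin R), (∀ u, ∀ s ≤ t, ω u s = ω' u s) →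
    ∀ u, adv ω u t = adv ω' u t

/-! ### Parameters -/

/-- `log₂ Δ`, read as `0` if the graph has no edges. -/
noncomputable def lg (Δ : ℕ) : ℝ := Real.logb 2 (max (Δ : ℝ) 1)

/-- The number `I` of slots of an interval. -/
noncomputable def intervalLength (ε : ℝ) : ℕ :=
  ⌈2000 * (Real.log 1500 + Real.log (2 / ε))⌉₊

/-- The number `R` of rounds. -/
noncomputable def numRounds (Δ : ℕ) (ε : ℝ) : ℕ :=
  ⌈104000 * (lg Δ + Real.logb 2 (2 / ε))⌉₊

/-- The event that node `v` terminates within time `T` with a locally correct decision, where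
`adv ω` are the coin tosses and `exec ω` is the execution when the random outcome is `ω`. -/
def goodEvent {V : Type*} {I R : ℕ} (G : SimpleGraph V) (f : ℕ)
    (adv : Coins V I R → Coins V I R) (exec : Coins V I R → Trace V Message)
    (v : V) (T : ℝ) : Set (Coins V I R) :=
  {ω | (∃ τ : ℕ, (τ : ℝ) ≤ T ∧ TerminatedAt f (adv ω) (exec ω) v τ) ∧
    LocallyCorrect G (outputAt f (adv ω) (exec ω)) v}

end BeepMIS

/-!
In a slot, a node hears a beep exactly when some neighbor beeps: a beep that is acknowledged early
has already reached all neighbors, and any other one lasts for the whole slot, so that the progress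
bound applies (`IsExecution.hears_iff`). Hence the MAC layer has no influence, and the execution is
the synchronous beeping algorithm `run` (`IsExecution.nodeState_eq_run`). A node that becomes `IN`
makes all its undecided neighbors `OUT` one slot later, so the decision of `v` is locally correct
unless a neighbor becomes `IN` in the same slot (`IsExecution.locallyCorrect`).

For the probabilities, the coins of a round are averaged with all earlier rounds fixed. Only coins
in the 2-hop neighborhood of `v` matter for the bounds, and there the adversary has no influence.
Let `p` be the desire-level of `v`, and let its effective degree `d` be the sum of the desire-levels
of its active neighbors. Chernoff's method, with an explicit weight for each slot, shows that the
estimate of a node is correct up to a tiny error if its effective degree is at most `0.15` or at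
least `0.3` (`prob_high_le`, `prob_not_high_le`). Neighbors with effective degree at least `0.3`
therefore lower their desire-levels, and the others are good candidates for joining: if their
desire-levels sum to at least `0.01`, then one of them joins with constant probability
(`le_prob_ends_of_lowDegree`). So the potential `p ^ (-s) * (d + 1/5) ^ (7 * s)` with `s = 1/5000`,
set to `0` once `v` has terminated, shrinks by a constant factor in expectation in every round
(`expect_nodePotential_le`). As it is at most a power of the maximum degree initially, and bounded
from below while `v` is active, `v` has terminated after all rounds with probability at least
`1 - ε / 2`.

Given the past, `v` and a neighbor join simultaneously in a round with probability at most `p` times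
the probability that two given nodes choose the same slots (`prob_collision_le`). A union bound over
all rounds would cost a factor `log Δ`, but the sum of `p` over all rounds has bounded expectation,
since `v` joins with probability proportional to `p` if `d < 0.3` and `p` is expected to shrink
otherwise (`expect_budget_le`). As the number of choices of slots is exponential in the length of
the interval, a collision has probability at most `ε / 2`.
-/

namespace BeepMIS

/-! ### Reduction to a synchronous beeping algorithm -/

section Synchronous

variable {V : Type*} {I R : ℕ}

open Classical in
/-- Does some neighbor of `v` beep in slot `i` of a round? -/
noncomputable def neighborBeeps (G : SimpleGraph V) (c : V → RoundCoins I R) (i : ℕ)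
    (σ : V → NodeState) (v : V) : Bool :=
  decide (∃ u, G.Adj v u ∧ beeps (c u) i (σ u) = true)

lemma neighborBeeps_iff {G : SimpleGraph V} {c : V → RoundCoins I R} {i : ℕ}
    {σ : V → NodeState} {v : V} :
    neighborBeeps G c i σ v = true ↔ ∃ u, G.Adj v u ∧ beeps (c u) i (σ u) = true :=
  by classical exact decide_eq_true_iff

/-- One slot of the beeping algorithm, for all nodes at once and without a MAC layer: a node hears
a beep exactly when one of its neighbors beeps. -/
noncomputable def slotStep (G : SimpleGraph V) (c : V → RoundCoins I R) (i : ℕ)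
    (σ : V → NodeState) : V → NodeState :=
  fun v => step (c v) i (σ v) (neighborBeeps G c i σ v)

/-- The states of all nodes after `n` slots of the synchronous beeping algorithm. -/
noncomputable def run (G : SimpleGraph V) (ω : Coins V I R) : ℕ → V → NodeState
  | 0 => fun _ => NodeState.init
  | n + 1 =>
    if h : n / (2 * I + 1) < R then
      slotStep G (fun u => ω u ⟨n / (2 * I + 1), h⟩) (n % (2 * I + 1)) (run G ω n)
    else run G ω n

/-- Time steps of different slots are different. -/
lemma slot_unique {f n n' τ : ℕ} (h1 : n * f + 1 ≤ τ) (h2 : τ ≤ (n + 1) * f)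
    (h1' : n' * f + 1 ≤ τ) (h2' : τ ≤ (n' + 1) * f) : n = n' := by
  have hf : n * f < (n' + 1) * f := by omega
  have hf' : n' * f < (n + 1) * f := by omega
  have := Nat.lt_of_mul_lt_mul_right hf
  have := Nat.lt_of_mul_lt_mul_right hf'
  omega

variable {G : SimpleGraph V} {f fack : ℕ} {ω : Coins V I R} {α : Trace V Message}

/-- A broadcast is in progress only during the slot in which its sender beeps. -/
lemma IsExecution.slot_of_activeSince (h : IsExecution G f fack ω α) (hf : 1 ≤ f)
    {s τ : ℕ} {u : V} {m : Message} (ha : α.ActiveSince s τ u m) :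
    ∃ n, s = n * f + 1 ∧ τ ≤ (n + 1) * f ∧ WantsBeep f (ω u) α u n := by
  obtain ⟨hs, hb, hr⟩ := ha
  obtain ⟨n, rfl, hn⟩ := (h.bcst_iff _ _ _).1 hb
  refine ⟨n, rfl, ?_, hn⟩
  by_contra hlt
  refine (hr ((n + 1) * f) (by rw [add_mul]; omega) (by omega)).1 ?_
  exact (h.abort_iff _ _).2 ⟨n, rfl, hn⟩

/-- In one slot, a node receives a message exactly if some neighbor beeps: a beep that is
acknowledged early has reached all neighbors, any other one is covered by the progress bound. -/
lemma IsExecution.hears_iff (h : IsExecution G f fack ω α) (hf : 1 ≤ f) (n : ℕ) (v : V) :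
    Hears f α n v ↔ ∃ u, G.Adj v u ∧ WantsBeep f (ω u) α u n := by
  constructor
  · rintro ⟨τ, h1, h2, u, hu⟩
    obtain ⟨hadj, s, hs⟩ := h.mac.rcv_correct _ _ _ _ hu
    obtain ⟨n', rfl, h3, hw⟩ := h.slot_of_activeSince hf hs
    obtain rfl := slot_unique h1 h2 hs.1 h3
    exact ⟨u, hadj.symm, hw⟩
  · rintro ⟨u, hadj, hw⟩
    have hb : α.bcst (n * f + 1) u .beep := (h.bcst_iff _ _ _).2 ⟨n, rfl, hw⟩
    by_cases hack : ∃ r, n * f + 1 ≤ r ∧ r < (n + 1) * f ∧ α.ack r u .beep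
    · obtain ⟨r, hr1, hr2, hr⟩ := hack
      obtain ⟨s, hs, hall⟩ := h.mac.ack_correct _ _ _ hr
      obtain ⟨n', rfl, h3, -⟩ := h.slot_of_activeSince hf hs
      obtain rfl := slot_unique hr1 hr2.le hs.1 h3
      obtain ⟨r', hr1', hr2', hrcv⟩ := hall v hadj.symm
      exact ⟨r', hr1', by omega, u, hrcv⟩
    · push Not at hack
      have hact : α.ActiveSince (n * f + 1) (n * f + 1 + f - 1) u .beep := by
        refine ⟨by omega, hb, fun r hr1 hr2 => ⟨fun hab => ?_, hack r hr1 (by rw [add_mul]; omega)⟩⟩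
        obtain ⟨n', rfl, -⟩ := (h.abort_iff _ _).1 hab
        have h4 : n' = n := slot_unique (τ := (n' + 1) * f) (by rw [add_mul]; omega) le_rfl hr1
          (by rw [add_mul n]; omega)
        subst h4
        rw [add_mul] at hr2
        omega
      obtain ⟨r, hr1, hr2, w, ⟨⟩, hr⟩ := h.mac.progress u v hadj.symm (n * f + 1) .beep
        ⟨_, le_rfl, hact⟩
      exact ⟨r, hr1, by rw [add_mul]; omega, w, hr⟩

/-- The MAC layer has no influence on the states of the nodes. -/
lemma IsExecution.nodeState_eq_run (h : IsExecution G f fack ω α) (hf : 1 ≤ f) (n : ℕ) (v : V) :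
    nodeState f (ω v) α v n = run G ω n v := by
  induction n generalizing v with
  | zero => rfl
  | succ n ih =>
    rw [nodeState, run]
    split_ifs with hn
    · rw [slotStep, ih]
      congr 1
      rw [neighborBeeps, decide_eq_decide, h.hears_iff hf]
      refine exists_congr fun u => and_congr_right fun _ => ?_
      rw [WantsBeep, ih]
      exact ⟨fun ⟨_, h⟩ => h, fun h => ⟨hn, h⟩⟩
    · exact ih v

lemma run_congr {ω' : Coins V I R} {n : ℕ}
    (h : ∀ u (t : Fin R), (t : ℕ) * (2 * I + 1) < n → ω u t = ω' u t) :
    run G ω n = run G ω' n := by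
  induction n with
  | zero => rfl
  | succ n ih =>
    rw [run, run, ih fun u t ht => h u t (by omega)]
    split_ifs with hn
    · congr 1
      funext u
      exact h u _ (Nat.lt_succ_of_le (Nat.div_mul_le_self _ _))
    · rfl

end Synchronous

/-! ### Local correctness -/

section Correctness

variable {V : Type*} {I R : ℕ} {G : SimpleGraph V} {ω : Coins V I R}

lemma run_succ_of_lt {n : ℕ} (h : n / (2 * I + 1) < R) :
    run G ω (n + 1) =
      slotStep G (fun u => ω u ⟨n / (2 * I + 1), h⟩) (n % (2 * I + 1)) (run G ω n) := by
  rw [run, dif_pos h]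

lemma run_succ_of_not_lt {n : ℕ} (h : ¬ n / (2 * I + 1) < R) :
    run G ω (n + 1) = run G ω n := by
  rw [run, dif_neg h]

lemma step_of_terminated {ω : RoundCoins I R} {i : ℕ} {s : NodeState} {heard : Bool}
    (h : s.terminated = true) : step ω i s heard = s := by
  rw [step, if_pos h]

lemma step_first {ω : RoundCoins I R} {i : ℕ} {s : NodeState} {heard : Bool} (hi : i < I)
    (hs : s.terminated = false) :
    step ω i s heard = if beeps ω i s then s
      else { s with c := s.c + 1, b := if heard then s.b + 1 else s.b } := by
  rw [step, if_neg (by simp [hs]), if_pos hi]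

/-- Was the node disturbed by the end of slot `i` of the second interval? -/
def disturbedAfter (ω : RoundCoins I R) (i : ℕ) (s : NodeState) (heard : Bool) : Bool :=
  s.disturbed || (marked ω s && !(beeps ω i s) && heard)

lemma step_second {ω : RoundCoins I R} {i : ℕ} {s : NodeState} {heard : Bool} (hi : I ≤ i)
    (hi' : i < 2 * I) (hs : s.terminated = false) :
    step ω i s heard =
      { s with
        disturbed := disturbedAfter ω i s heard
        output := if i + 1 = 2 * I ∧ marked ω s = true ∧ disturbedAfter ω i s heard = false
          then some Decision.IN else s.output } := by
  rw [step, if_neg (by simp [hs]), if_neg (by omega), if_pos hi']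
  rfl

lemma step_last {ω : RoundCoins I R} {s : NodeState} {heard : Bool}
    (hs : s.terminated = false) :
    step ω (2 * I) s heard =
      if s.output = some Decision.IN then { s with terminated := true }
      else if heard then { s with output := some Decision.OUT, terminated := true }
      else { s with p := nextDesire ω s, c := 0, b := 0, disturbed := false } := by
  rw [step, if_neg (by simp [hs]), if_neg (by omega), if_neg (by omega)]

/-- Before the second interval ends, a slot changes neither the output nor the termination. -/
lemma step_early {ω : RoundCoins I R} {i : ℕ} {s : NodeState} {heard : Bool}
    (hi : i + 1 < 2 * I) :
    (step ω i s heard).output = s.output ∧ (step ω i s heard).terminated = s.terminated := by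
  rcases hs : s.terminated with _ | _
  · rcases lt_or_ge i I with h | h
    · rw [step_first h hs]
      split_ifs <;> simp [hs]
    · rw [step_second h (by omega) hs, if_neg (by omega)]
      simp [hs]
  · rw [step_of_terminated hs, hs]
    simp

/-- In the last slot of a round, exactly the nodes that have just output `IN` beep. -/
lemma beeps_last {ω : RoundCoins I R} {s : NodeState} :
    beeps ω (2 * I) s = true ↔ s.terminated = false ∧ s.output = some .IN := by
  rw [beeps]
  have h1 : ¬ 2 * I < I := by omega
  have h2 : ¬ 2 * I - I < I := by omega
  cases s.terminated <;> simp [h1, h2]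

/-- An undecided node is active, a node that is `OUT` has terminated, and a node that is `IN` is
active only at the end of a second interval. -/
structure Consistent (I R n : ℕ) (s : NodeState) : Prop where
  decided : s.terminated = true → s.output ≠ none
  out : s.output = some .OUT → s.terminated = true
  active_in : s.output = some .IN → s.terminated = false →
    n % (2 * I + 1) = 2 * I ∧ n / (2 * I + 1) < R

lemma consistent_run (n : ℕ) (v : V) : Consistent I R n (run G ω n v) := by
  induction n with
  | zero => constructor <;> simp [run, NodeState.init]
  | succ n ih =>
    by_cases hn : n / (2 * I + 1) < R
    · rw [run_succ_of_lt hn, slotStep]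
      generalize neighborBeeps _ _ _ _ _ = heard
      set s := run G ω n v
      have hmod : n % (2 * I + 1) < 2 * I + 1 := Nat.mod_lt _ (by omega)
      rcases hs : s.terminated with _ | _
      · have hnone : n % (2 * I + 1) < 2 * I → s.output = none := by
          intro hlt
          rcases ho : s.output with _ | _ | _
          · rfl
          · exact absurd (ih.active_in ho hs).1 (by omega)
          · simp [ih.out ho] at hs
        rcases lt_trichotomy (n % (2 * I + 1) + 1) (2 * I) with hi | hi | hi
        · obtain ⟨h1, h2⟩ := step_early (ω := ω v ⟨n / (2 * I + 1), hn⟩) (s := s)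
            (heard := heard) hi
          constructor <;> rw [h1, hnone (by omega)] <;> simp [h2, hs]
        · rw [step_second (by omega) (by omega) hs]
          refine ⟨by simp [hs], ?_, fun _ _ => ?_⟩
          · dsimp only
            split_ifs <;> simp [hnone (by omega)]
          · have h3 : n + 1 = 2 * I + (2 * I + 1) * (n / (2 * I + 1)) := by
              have := Nat.mod_add_div n (2 * I + 1)
              omega
            rw [h3, Nat.add_mul_mod_self_left, Nat.add_mul_div_left _ _ (by omega),
              Nat.mod_eq_of_lt (by omega), Nat.div_eq_of_lt (by omega)]
            exact ⟨rfl, by omega⟩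
        · rw [show n % (2 * I + 1) = 2 * I by omega, step_last hs]
          split_ifs with ho
          · exact ⟨by simp [ho], by simp, by simp⟩
          · constructor <;> simp
          · exact ⟨ih.decided, ih.out, fun h => absurd h ho⟩
      · rw [step_of_terminated hs]
        exact ⟨ih.decided, ih.out, by simp [hs]⟩
    · rw [run_succ_of_not_lt hn]
      exact ⟨ih.decided, ih.out, fun h h' => absurd (ih.active_in h h').2 hn⟩

lemma output_run_succ {n : ℕ} {v : V} {d : Decision} (h : (run G ω n v).output = some d) :
    (run G ω (n + 1) v).output = some d := by
  by_cases hn : n / (2 * I + 1) < R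
  · have ih := consistent_run (G := G) (ω := ω) n v
    rw [run_succ_of_lt hn, slotStep]
    generalize neighborBeeps _ _ _ _ _ = heard
    set s := run G ω n v
    rcases hs : s.terminated with _ | _
    · cases d with
      | OUT => simp [ih.out h] at hs
      | IN =>
        have hi := (ih.active_in h hs).1
        rw [hi, step_last hs, if_pos h]
        exact h
    · rwa [step_of_terminated hs]
  · rwa [run_succ_of_not_lt hn]

lemma output_run_mono {n n' : ℕ} (hnn : n ≤ n') {v : V} {d : Decision}
    (h : (run G ω n v).output = some d) : (run G ω n' v).output = some d := by
  induction n', hnn using Nat.le_induction with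
  | base => exact h
  | succ n' _ ih => exact output_run_succ ih

lemma active_of_new_in {n : ℕ} {u : V} (h0 : (run G ω n u).output ≠ some .IN)
    (h1 : (run G ω (n + 1) u).output = some .IN) : (run G ω (n + 1) u).terminated = false := by
  by_contra hc
  rw [Bool.not_eq_false] at hc
  by_cases hn : n / (2 * I + 1) < R
  · have ih := consistent_run (G := G) (ω := ω) n u
    rw [run_succ_of_lt hn, slotStep] at hc h1
    generalize neighborBeeps _ _ _ _ _ = heard at hc h1
    set s := run G ω n u
    rcases hs : s.terminated with _ | _
    · have hmod : n % (2 * I + 1) < 2 * I + 1 := Nat.mod_lt _ (by omega)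
      rcases lt_trichotomy (n % (2 * I + 1) + 1) (2 * I) with hi | hi | hi
      · rw [(step_early hi).1] at h1
        exact h0 h1
      · rw [step_second (by omega) (by omega) hs] at hc
        simp [hs] at hc
      · rw [show n % (2 * I + 1) = 2 * I by omega, step_last hs, if_neg h0] at h1
        split_ifs at h1
        · simp at h1
        · exact h0 h1
    · rw [step_of_terminated hs] at h1
      exact h0 h1
  · rw [run_succ_of_not_lt hn] at h1
    exact h0 h1

/-- A node that becomes `IN` silences its neighbors in the next slot: they all have an output
then, and those that were undecided are `OUT`. -/
lemma neighbor_decided {n : ℕ} {u v : V} (hadj : G.Adj v u)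
    (h0 : (run G ω n u).output ≠ some .IN) (h1 : (run G ω (n + 1) u).output = some .IN) :
    (run G ω (n + 2) v).output ≠ none ∧
      ((run G ω (n + 2) v).output = some .IN → (run G ω (n + 1) v).output = some .IN) := by
  have hterm := active_of_new_in h0 h1
  obtain ⟨hi, hR⟩ := (consistent_run (G := G) (ω := ω) (n + 1) u).active_in h1 hterm
  have ihv := consistent_run (G := G) (ω := ω) (n + 1) v
  rw [show n + 2 = n + 1 + 1 from rfl, run_succ_of_lt hR, slotStep, hi]
  rw [neighborBeeps_iff.2 ⟨u, hadj, beeps_last.2 ⟨hterm, h1⟩⟩]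
  rcases hs : (run G ω (n + 1) v).terminated with _ | _
  · rw [step_last hs, if_pos rfl]
    split_ifs with ho <;> simp [ho]
  · rw [step_of_terminated hs]
    exact ⟨ihv.decided hs, id⟩

/-- Once a node is `IN` at a time when its neighbor is not, the neighbor is never `IN`. -/
lemma neighbor_not_in {n : ℕ} {u v : V} (hadj : G.Adj v u)
    (hu : (run G ω n u).output = some .IN) (hv : (run G ω n v).output ≠ some .IN) (n' : ℕ) :
    (run G ω n' v).output ≠ some .IN := by
  have hex : ∃ n, (run G ω n u).output = some .IN := ⟨n, hu⟩
  classical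
  obtain ⟨m, hm⟩ : ∃ m, Nat.find hex = m + 1 := by
    refine Nat.exists_eq_succ_of_ne_zero fun h0 => ?_
    have := Nat.find_spec hex
    rw [h0] at this
    simp [run, NodeState.init] at this
  have h1 := Nat.find_spec hex
  have h0 := Nat.find_min hex (m := m) (by omega)
  have hmn : m + 1 ≤ n := hm ▸ Nat.find_min' hex hu
  rw [hm] at h1
  obtain ⟨hne, himp⟩ := neighbor_decided hadj h0 h1
  have hv1 : (run G ω (m + 1) v).output ≠ some .IN := fun h => hv (output_run_mono hmn h)
  have hout : (run G ω (m + 2) v).output = some .OUT := by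
    rcases ho : (run G ω (m + 2) v).output with _ | _ | _
    · exact absurd ho hne
    · exact absurd (himp ho) hv1
    · rfl
  intro hc
  rcases le_total n' (m + 2) with h | h
  · simp [output_run_mono h hc] at hout
  · simp [output_run_mono h hout] at hc

/-- A node that is `OUT` has a neighbor that is `IN`. -/
lemma exists_neighbor_in {n : ℕ} {v : V} (h : (run G ω n v).output = some .OUT) :
    ∃ u, G.Adj v u ∧ (run G ω n u).output = some .IN := by
  induction n with
  | zero => simp [run, NodeState.init] at h
  | succ n ih =>
    by_cases hprev : (run G ω n v).output = some .OUT
    · obtain ⟨u, hu, hin⟩ := ih hprev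
      exact ⟨u, hu, output_run_succ hin⟩
    · by_cases hn : n / (2 * I + 1) < R
      · rw [run_succ_of_lt hn, slotStep] at h
        have hmod : n % (2 * I + 1) < 2 * I + 1 := Nat.mod_lt _ (by omega)
        rcases hs : (run G ω n v).terminated with _ | _
        · rcases lt_trichotomy (n % (2 * I + 1) + 1) (2 * I) with hi | hi | hi
          · rw [(step_early hi).1] at h
            exact absurd h hprev
          · rw [step_second (by omega) (by omega) hs] at h
            dsimp only at h
            split_ifs at h
            exacts [absurd h (by simp), absurd h hprev]
          · have hi : n % (2 * I + 1) = 2 * I := by omega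
            rw [hi, step_last hs] at h
            split_ifs at h with h1 h2
            · exact absurd h hprev
            · obtain ⟨u, hu, hb⟩ := neighborBeeps_iff.1 h2
              exact ⟨u, hu, output_run_succ (beeps_last.1 hb).2⟩
            · exact absurd h hprev
        · rw [step_of_terminated hs] at h
          exact absurd h hprev
      · rw [run_succ_of_not_lt hn] at h
        exact absurd h hprev

variable {f fack : ℕ} {α : Trace V Message}

lemma IsExecution.outputAt_eq (h : IsExecution G f fack ω α) (hf : 1 ≤ f) (v : V) (τ : ℕ) :
    outputAt f ω α v τ = (run G ω (τ / f) v).output := by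
  rw [outputAt, h.nodeState_eq_run hf]

lemma IsExecution.terminatedAt_iff (h : IsExecution G f fack ω α) (hf : 1 ≤ f) (v : V) (τ : ℕ) :
    TerminatedAt f ω α v τ ↔ (run G ω (τ / f) v).terminated = true := by
  rw [TerminatedAt, h.nodeState_eq_run hf]

/-- Nodes `v` and `u` output `IN` at the end of the same slot. -/
def Simultaneous (G : SimpleGraph V) (ω : Coins V I R) (v u : V) (n : ℕ) : Prop :=
  (run G ω n v).output = none ∧ (run G ω (n + 1) v).output = some .IN ∧
    (run G ω n u).output = none ∧ (run G ω (n + 1) u).output = some .IN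

lemma makesOutput_of_slot (h : IsExecution G f fack ω α) (hf : 1 ≤ f) {v : V} {n : ℕ}
    {d : Decision} (h0 : (run G ω n v).output = none)
    (h1 : (run G ω (n + 1) v).output = some d) :
    MakesOutput (outputAt f ω α) v d ((n + 1) * f) := by
  refine ⟨by rw [h.outputAt_eq hf, Nat.mul_div_cancel _ hf, h1], fun σ hσ => ?_⟩
  rw [h.outputAt_eq hf]
  by_contra hc
  obtain ⟨d', hd'⟩ := Option.ne_none_iff_exists'.1 hc
  have : σ / f ≤ n := Nat.lt_succ_iff.1 ((Nat.div_lt_iff_lt_mul hf).2 hσ)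
  simp [output_run_mono this hd'] at h0

/-- If `v` never joins simultaneously with a neighbor, then its decision is locally correct. -/
lemma IsExecution.locallyCorrect (h : IsExecution G f fack ω α) (hf : 1 ≤ f) {v : V}
    (hsim : ∀ u n, G.Adj v u → ¬ Simultaneous G ω v u n) :
    LocallyCorrect G (outputAt f ω α) v := by
  constructor
  · intro d τ σ hτσ hd
    rw [h.outputAt_eq hf] at hd ⊢
    exact output_run_mono (Nat.div_le_div_right hτσ) hd
  · rintro τ ⟨hτ, hbefore⟩ u hadj
    rw [h.outputAt_eq hf] at hτ
    -- the last slot before the output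
    obtain ⟨n, hn⟩ : ∃ n, τ / f = n + 1 := by
      refine Nat.exists_eq_succ_of_ne_zero fun h0 => ?_
      rw [h0] at hτ
      simp [run, NodeState.init] at hτ
    have h0 : (run G ω n v).output = none := by
      have hlt : n * f < τ := by
        have : (n + 1) * f ≤ τ := hn ▸ Nat.div_mul_le_self τ f
        rw [add_mul] at this
        omega
      have := hbefore _ hlt
      rwa [h.outputAt_eq hf, Nat.mul_div_cancel _ hf] at this
    rw [hn] at hτ
    have hu : ∀ n', (run G ω n' u).output ≠ some .IN := by
      by_cases hu1 : (run G ω (n + 1) u).output = some .IN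
      · exfalso
        rcases hu0 : (run G ω n u).output with _ | _ | _
        · exact hsim u n hadj ⟨h0, hτ, hu0, hu1⟩
        · exact neighbor_not_in hadj hu0 (by simp [h0]) _ hτ
        · simp [output_run_succ hu0] at hu1
      · exact neighbor_not_in hadj.symm hτ hu1
    refine ⟨by rw [h.outputAt_eq hf]; exact hu _, fun σ _ hσ => ?_⟩
    have := hσ.1
    rw [h.outputAt_eq hf] at this
    exact hu _ this
  · rintro τ ⟨hτ, -⟩
    rw [h.outputAt_eq hf] at hτ
    obtain ⟨u, hu, hin⟩ := exists_neighbor_in hτ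
    exact ⟨u, hu, by rw [h.outputAt_eq hf, hin]⟩

end Correctness

/-! ### The outcome of a round -/

section Round

variable {V : Type*} {I R : ℕ}

/-- The probability with which a node beeps in the current round: its desire-level, and `0` once
it has terminated. -/
def weight (s : NodeState) : ℚ := if s.terminated then 0 else s.p

lemma weight_of_terminated {s : NodeState} (h : s.terminated = true) : weight s = 0 := if_pos h

lemma weight_of_active {s : NodeState} (h : s.terminated = false) : weight s = s.p :=
  if_neg (by simp [h])

lemma hits_zero (U : Fin (2 ^ R)) : hits U 0 = false := by
  rw [hits, decide_eq_false_iff_not, not_lt]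
  positivity

/-- Node `u` beeps in slot `i` of the first interval, if `q` are the beeping probabilities. -/
def Signals (c : V → RoundCoins I R) (q : V → ℚ) (u : V) (i : Fin I) : Prop :=
  hits ((c u).1 i) (q u) = true

/-- Node `u` is marked, if `q` are the marking probabilities. -/
def Marks (c : V → RoundCoins I R) (q : V → ℚ) (u : V) : Prop := hits (c u).2.2.1 (q u) = true

open Classical in
/-- The number of slots of the first interval in which `u` listens. -/
noncomputable def listenCount (c : V → RoundCoins I R) (q : V → ℚ) (u : V) : ℕ :=
  (Finset.univ.filter fun i => ¬ Signals c q u i).card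

open Classical in
/-- The number of slots of the first interval in which `u` hears a beep. -/
noncomputable def heardCount (G : SimpleGraph V) (c : V → RoundCoins I R) (q : V → ℚ) (u : V) : ℕ :=
  (Finset.univ.filter fun i => ¬ Signals c q u i ∧ ∃ w, G.Adj u w ∧ Signals c q w i).card

/-- The estimate of node `u` is "high". -/
def High (G : SimpleGraph V) (c : V → RoundCoins I R) (q : V → ℚ) (u : V) : Prop :=
  if (listenCount c q u : ℚ) ≤ (I : ℚ) / 3 then (c u).2.1 = true
  else (heardCount G c q u : ℚ) / listenCount c q u > 1 / 5

/-- Node `u` is marked and hears no beep in the second interval. -/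
def Joins (G : SimpleGraph V) (c : V → RoundCoins I R) (q : V → ℚ) (u : V) : Prop :=
  Marks c q u ∧ ∀ w, G.Adj u w → Marks c q w → (c w).2.2.2.1 ⊆ (c u).2.2.2.1

/-- The states after the first `k` slots of a round that starts in `σ`. -/
noncomputable def slots (G : SimpleGraph V) (c : V → RoundCoins I R) (σ : V → NodeState) :
    ℕ → V → NodeState
  | 0 => σ
  | k + 1 => slotStep G c k (slots G c σ k)

/-- At the beginning of a round, the desire-level is the only relevant variable of an active
node. -/
def Fresh (s : NodeState) : Prop := s.terminated = false → s = ⟨s.p, 0, 0, false, none, false⟩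

variable {G : SimpleGraph V} {c : V → RoundCoins I R} {σ : V → NodeState}

lemma run_add_eq_slots {ω : Coins V I R} (t : Fin R) {k : ℕ} (hk : k ≤ 2 * I + 1) :
    run G ω (t * (2 * I + 1) + k) = slots G (fun u => ω u t) (run G ω (t * (2 * I + 1))) k := by
  induction k with
  | zero => rfl
  | succ k ih =>
    have hdiv : (t * (2 * I + 1) + k) / (2 * I + 1) = t := by
      rw [mul_comm, Nat.mul_add_div (by omega), Nat.div_eq_of_lt (by omega), add_zero]
    have hmod : (t * (2 * I + 1) + k) % (2 * I + 1) = k := by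
      rw [mul_comm, Nat.mul_add_mod, Nat.mod_eq_of_lt (by omega)]
    rw [← add_assoc, run_succ_of_lt (by rw [hdiv]; exact t.2), slots, ih (by omega)]
    simp only [hdiv, hmod]

lemma slots_of_terminated {u : V} (h : (σ u).terminated = true) (k : ℕ) :
    slots G c σ k u = σ u := by
  induction k with
  | zero => rfl
  | succ k ih => rw [slots, slotStep, step_of_terminated (by rw [ih, h]), ih]

lemma beeps_first {ω : RoundCoins I R} {i : ℕ} {s : NodeState} (hi : i < I) :
    beeps ω i s = hits (ω.1 ⟨i, hi⟩) (weight s) := by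
  rw [beeps, weight]
  split_ifs <;> simp [hits_zero]

lemma beeps_second {ω : RoundCoins I R} {i : ℕ} {s : NodeState} (hi : i < I) :
    beeps ω (I + i) s =
      (hits ω.2.2.1 (weight s) && decide (⟨i, hi⟩ ∈ ω.2.2.2.1)) := by
  rw [beeps, weight]
  have h1 : ¬ I + i < I := by omega
  have h2 : I + i - I < I := by omega
  split_ifs <;> simp [hits_zero, marked]

lemma card_filter_lt_succ {k : ℕ} (hk : k < I) (P : Fin I → Prop) [DecidablePred P] :
    (Finset.univ.filter fun i : Fin I => (i : ℕ) < k + 1 ∧ P i).card =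
      (Finset.univ.filter fun i : Fin I => (i : ℕ) < k ∧ P i).card +
        if P ⟨k, hk⟩ then 1 else 0 := by
  split_ifs with h
  · rw [← Finset.card_insert_of_notMem (a := ⟨k, hk⟩) (by simp)]
    congr 1
    ext i
    simp only [Finset.mem_filter, Finset.mem_univ, true_and, Finset.mem_insert, Fin.ext_iff]
    constructor
    · rintro ⟨h1, h2⟩
      rcases Nat.lt_succ_iff_lt_or_eq.1 h1 with h3 | h3
      exacts [.inr ⟨h3, h2⟩, .inl h3]
    · rintro (h1 | h1)
      · exact ⟨by omega, by rwa [show i = ⟨k, hk⟩ from Fin.ext h1]⟩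
      · exact ⟨by omega, h1.2⟩
  · rw [add_zero]
    congr 1
    ext i
    simp only [Finset.mem_filter, Finset.mem_univ, true_and]
    constructor
    · rintro ⟨h1, h2⟩
      rcases Nat.lt_succ_iff_lt_or_eq.1 h1 with h3 | h3
      · exact ⟨h3, h2⟩
      · exact absurd (by rwa [show i = ⟨k, hk⟩ from Fin.ext h3] at h2) h
    · rintro ⟨h1, h2⟩
      exact ⟨by omega, h2⟩

/-- The beeping probabilities in a round that starts in the states `σ`. -/
def weights (σ : V → NodeState) : V → ℚ := fun u => weight (σ u)

open Classical in
/-- The state of an active node after `k` slots of the first interval. -/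
lemma slots_first {k : ℕ} (hk : k ≤ I) (hσ : ∀ u, Fresh (σ u)) {u : V}
    (hu : (σ u).terminated = false) :
    slots G c σ k u = ⟨(σ u).p,
      (Finset.univ.filter fun i : Fin I => (i : ℕ) < k ∧ ¬ Signals c (weights σ) u i).card,
      (Finset.univ.filter fun i : Fin I => (i : ℕ) < k ∧ (¬ Signals c (weights σ) u i ∧
        ∃ w, G.Adj u w ∧ Signals c (weights σ) w i)).card, false, none, false⟩ := by
  induction k generalizing u with
  | zero =>
    rw [slots]
    convert hσ u hu <;> simp
  | succ k ih =>
    have hw : ∀ w, weight (slots G c σ k w) = weights σ w := by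
      intro w
      rcases hs : (σ w).terminated with _ | _
      · rw [ih (by omega) hs, weights, weight_of_active hs]; rfl
      · rw [slots_of_terminated hs]; rfl
    have hn : neighborBeeps G c k (slots G c σ k) u =
        decide (∃ w, G.Adj u w ∧ Signals c (weights σ) w ⟨k, hk⟩) := by
      rw [Bool.eq_iff_iff, neighborBeeps_iff, decide_eq_true_iff]
      simp only [beeps_first hk, hw, Signals]
    rw [slots, slotStep, hn, step_first hk (by rw [ih (by omega) hu]), beeps_first hk,
      hw, ih (by omega) hu, card_filter_lt_succ hk fun i => ¬ Signals c (weights σ) u i,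
      card_filter_lt_succ hk fun i => ¬ Signals c (weights σ) u i ∧
        ∃ w, G.Adj u w ∧ Signals c (weights σ) w i]
    by_cases h1 : Signals c (weights σ) u ⟨k, hk⟩
    · rw [if_pos (by exact h1)]
      simp [h1]
    · rw [if_neg (by exact h1)]
      by_cases h2 : ∃ w, G.Adj u w ∧ Signals c (weights σ) w ⟨k, hk⟩ <;> simp [h1, h2]

open Classical in
/-- The state of an active node after `k` slots of the second interval. -/
lemma slots_second {k : ℕ} (hk : k ≤ I) (hI : 0 < I) (hσ : ∀ u, Fresh (σ u)) {u : V}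
    (hu : (σ u).terminated = false) :
    slots G c σ (I + k) u = ⟨(σ u).p, listenCount c (weights σ) u, heardCount G c (weights σ) u,
      decide (Marks c (weights σ) u ∧ ∃ i : Fin I, (i : ℕ) < k ∧ i ∉ (c u).2.2.2.1 ∧
        ∃ w, G.Adj u w ∧ Marks c (weights σ) w ∧ i ∈ (c w).2.2.2.1),
      if k = I ∧ Joins G c (weights σ) u then some .IN else none, false⟩ := by
  induction k generalizing u with
  | zero =>
    rw [add_zero, slots_first le_rfl hσ hu, if_neg (by omega)]
    simp [listenCount, heardCount]
  | succ k ih =>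
    have hw : ∀ w, weight (slots G c σ (I + k) w) = weights σ w := by
      intro w
      rcases hs : (σ w).terminated with _ | _
      · rw [ih (by omega) hs, weights, weight_of_active hs]; rfl
      · rw [slots_of_terminated hs]; rfl
    have hterm : (slots G c σ (I + k) u).terminated = false := by rw [ih (by omega) hu]
    have hb : ∀ w, beeps (c w) (I + k) (slots G c σ (I + k) w) = true ↔
        Marks c (weights σ) w ∧ ⟨k, hk⟩ ∈ (c w).2.2.2.1 := by
      intro w
      rw [beeps_second hk, hw, Bool.and_eq_true, decide_eq_true_iff, Marks]
    have hn : neighborBeeps G c (I + k) (slots G c σ (I + k)) u = true ↔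
        ∃ w, G.Adj u w ∧ Marks c (weights σ) w ∧ ⟨k, hk⟩ ∈ (c w).2.2.2.1 := by
      rw [neighborBeeps_iff]
      simp only [hb]
    have hm : marked (c u) (slots G c σ (I + k) u) = true ↔ Marks c (weights σ) u := by
      rw [Marks, ← hw, weight_of_active hterm, marked]
    have hd : disturbedAfter (c u) (I + k) (slots G c σ (I + k) u)
        (neighborBeeps G c (I + k) (slots G c σ (I + k)) u) =
        decide (Marks c (weights σ) u ∧ ∃ i : Fin I, (i : ℕ) < k + 1 ∧ i ∉ (c u).2.2.2.1 ∧
          ∃ w, G.Adj u w ∧ Marks c (weights σ) w ∧ i ∈ (c w).2.2.2.1) := by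
      rw [Bool.eq_iff_iff, disturbedAfter, Bool.or_eq_true, Bool.and_eq_true, Bool.and_eq_true,
        Bool.not_eq_true', ← Bool.not_eq_true, hb, hn, hm, decide_eq_true_iff, ih (by omega) hu,
        decide_eq_true_iff]
      constructor
      · rintro (⟨h1, i, h2, h3⟩ | ⟨⟨h1, h2⟩, h3⟩)
        · exact ⟨h1, i, by omega, h3⟩
        · exact ⟨h1, ⟨k, hk⟩, by simp, fun h => h2 ⟨h1, h⟩, h3⟩
      · rintro ⟨h1, i, h2, h3, h4⟩
        rcases Nat.lt_succ_iff_lt_or_eq.1 h2 with h5 | h5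
        · exact .inl ⟨h1, i, h5, h3, h4⟩
        · obtain rfl : i = ⟨k, hk⟩ := Fin.ext h5
          exact .inr ⟨⟨h1, fun h => h3 h.2⟩, h4⟩
    rw [← add_assoc, slots, slotStep, step_second (by omega) (by omega) hterm, hd]
    simp only [hm]
    rw [ih (by omega) hu]
    have hout : (I + k + 1 = 2 * I ∧ Marks c (weights σ) u ∧
        decide (Marks c (weights σ) u ∧ ∃ i : Fin I, (i : ℕ) < k + 1 ∧ i ∉ (c u).2.2.2.1 ∧
          ∃ w, G.Adj u w ∧ Marks c (weights σ) w ∧ i ∈ (c w).2.2.2.1) = false) ↔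
        (k + 1 = I ∧ Joins G c (weights σ) u) := by
      rw [decide_eq_false_iff_not, Joins, show I + k + 1 = 2 * I ↔ k + 1 = I by omega]
      refine and_congr_right fun hkI => and_congr_right fun h1 => ?_
      push Not
      constructor
      · intro h2 w hw1 hw2 i hi
        by_contra h3
        exact h2 h1 i (by omega) h3 w hw1 hw2 hi
      · intro h2 _ i _ h3 w hw1 hw2 hi
        exact h3 (h2 w hw1 hw2 hi)
    simp only [hout, show ¬ k = I by omega, false_and, if_false]

lemma output_slots_second_iff (hI : 0 < I) (hσ : ∀ u, Fresh (σ u)) {u : V}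
    (hu : (σ u).terminated = false) :
    (slots G c σ (2 * I) u).output = some .IN ↔ Joins G c (weights σ) u := by
  rw [two_mul, slots_second le_rfl hI hσ hu]
  simp

lemma not_joins_of_terminated {u : V} (hu : (σ u).terminated = true) :
    ¬ Joins G c (weights σ) u := by
  rintro ⟨h, -⟩
  rw [Marks, weights, weight_of_terminated hu, hits_zero] at h
  cases h

lemma beeps_last_slots (hI : 0 < I) (hσ : ∀ u, Fresh (σ u)) (u : V) :
    beeps (c u) (2 * I) (slots G c σ (2 * I) u) = true ↔ Joins G c (weights σ) u := by
  rw [beeps_last]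
  rcases hu : (σ u).terminated with _ | _
  · rw [output_slots_second_iff hI hσ hu, two_mul, slots_second le_rfl hI hσ hu]
    simp
  · simp [slots_of_terminated hu, hu, not_joins_of_terminated hu]

/-- A node that joins terminates, and so do its neighbors. -/
lemma terminated_of_joins (hI : 0 < I) (hσ : ∀ u, Fresh (σ u)) {u w : V}
    (hw : Joins G c (weights σ) w) (huw : u = w ∨ G.Adj u w) :
    (slots G c σ (2 * I + 1) u).terminated = true := by
  rcases hu : (σ u).terminated with _ | _
  · have hterm : (slots G c σ (2 * I) u).terminated = false := by
      rw [two_mul, slots_second le_rfl hI hσ hu]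
    have hout := output_slots_second_iff (G := G) (c := c) hI hσ hu
    rw [slots, slotStep, step_last hterm]
    rcases huw with rfl | h
    · rw [if_pos (hout.2 hw)]
    · rw [neighborBeeps_iff.2 ⟨w, h, (beeps_last_slots hI hσ w).2 hw⟩]
      rw [if_pos rfl]
      split_ifs <;> rfl
  · rw [slots_of_terminated hu, hu]

/-- The desire-level of the next round. -/
noncomputable def nextWeight (G : SimpleGraph V) (c : V → RoundCoins I R) (q : V → ℚ) (u : V) :
    ℚ :=
  open Classical in if High G c q u then q u / 2 else min (2 * q u) (1 / 2)

/-- A node that survives a round has only changed its desire-level. -/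
lemma slots_last (hI : 0 < I) (hσ : ∀ u, Fresh (σ u)) {u : V}
    (hu : (slots G c σ (2 * I + 1) u).terminated = false) :
    slots G c σ (2 * I + 1) u = ⟨nextWeight G c (weights σ) u, 0, 0, false, none, false⟩ := by
  have hu0 : (σ u).terminated = false := by
    by_contra h
    rw [Bool.not_eq_false] at h
    rw [slots_of_terminated h, h] at hu
    cases hu
  have hterm : (slots G c σ (2 * I) u).terminated = false := by
    rw [two_mul, slots_second le_rfl hI hσ hu0]
  have hj : ¬ Joins G c (weights σ) u := fun h => by
    rw [terminated_of_joins hI hσ h (.inl rfl)] at hu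
    cases hu
  have hn : ¬ neighborBeeps G c (2 * I) (slots G c σ (2 * I)) u = true := by
    rw [neighborBeeps_iff]
    rintro ⟨w, hw, hb⟩
    rw [terminated_of_joins hI hσ ((beeps_last_slots hI hσ w).1 hb) (.inr hw)] at hu
    cases hu
  rw [slots, slotStep, step_last hterm, if_neg (mt (output_slots_second_iff hI hσ hu0).1 hj),
    if_neg hn, two_mul, slots_second le_rfl hI hσ hu0]
  simp only [hj, and_false, if_false]
  congr 1
  have hp : weights σ u = (σ u).p := weight_of_active hu0
  have he : ∀ s : NodeState, s.c = listenCount c (weights σ) u →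
      s.b = heardCount G c (weights σ) u →
      (estimateHigh (c u) s = true ↔ High G c (weights σ) u) := by
    intro s h1 h2
    rw [estimateHigh, High, h1, h2]
    split_ifs
    · rfl
    · exact decide_eq_true_iff
  rw [nextDesire, nextWeight, hp]
  by_cases h : High G c (weights σ) u
  · rw [if_pos ((he _ rfl rfl).2 h), if_pos h]
  · rw [if_neg (mt (he _ rfl rfl).1 h), if_neg h]

lemma Fresh.slots (hI : 0 < I) (hσ : ∀ u, Fresh (σ u)) (u : V) :
    Fresh (slots G c σ (2 * I + 1) u) := by
  intro hu
  rw [slots_last hI hσ hu]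

end Round

/-! ### Uniform probability on finite types -/

section FiniteProbability

open scoped BigOperators

variable {ι κ α β : Type*}

open Classical in
/-- The indicator of a proposition, as a real number. -/
noncomputable def ind (P : Prop) : ℝ := if P then 1 else 0

lemma ind_of {P : Prop} (h : P) : ind P = 1 := if_pos h

lemma ind_of_not {P : Prop} (h : ¬ P) : ind P = 0 := if_neg h

lemma ind_nonneg (P : Prop) : 0 ≤ ind P := by
  rw [ind]; split_ifs <;> norm_num

lemma ind_le_one (P : Prop) : ind P ≤ 1 := by
  rw [ind]; split_ifs <;> norm_num

lemma ind_mono {P Q : Prop} (h : P → Q) : ind P ≤ ind Q := by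
  by_cases hP : P
  · rw [ind_of hP, ind_of (h hP)]
  · rw [ind_of_not hP]; exact ind_nonneg Q

lemma ind_not (P : Prop) : ind (¬ P) = 1 - ind P := by
  by_cases h : P
  · rw [ind_of h, ind_of_not (not_not.2 h)]; norm_num
  · rw [ind_of_not h, ind_of h]; norm_num

lemma ind_and (P Q : Prop) : ind (P ∧ Q) = ind P * ind Q := by
  by_cases h : P <;> by_cases h' : Q <;> simp [ind, h, h']

lemma ind_or_le (P Q : Prop) : ind (P ∨ Q) ≤ ind P + ind Q := by
  by_cases h : P <;> by_cases h' : Q <;> simp [ind, h, h']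

/-- The probability of an event under the uniform distribution of a finite type. -/
noncomputable def prob [Fintype α] (P : α → Prop) : ℝ := 𝔼 a, ind (P a)

lemma expect_mono [Fintype α] {f g : α → ℝ} (h : ∀ a, f a ≤ g a) : 𝔼 a, f a ≤ 𝔼 a, g a :=
  Finset.expect_le_expect fun a _ => h a

lemma prob_nonneg [Fintype α] (P : α → Prop) : 0 ≤ prob P :=
  Finset.expect_nonneg fun _ _ => ind_nonneg _

lemma prob_mono [Fintype α] {P Q : α → Prop} (h : ∀ a, P a → Q a) : prob P ≤ prob Q :=
  expect_mono fun a => ind_mono (h a)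

lemma prob_or_le [Fintype α] (P Q : α → Prop) : prob (fun a => P a ∨ Q a) ≤ prob P + prob Q := by
  rw [prob, prob, prob, ← Finset.expect_add_distrib]
  exact expect_mono fun a => ind_or_le _ _

lemma prob_not [Fintype α] [Nonempty α] (P : α → Prop) :
    prob (fun a => ¬ P a) = 1 - prob P := by
  simp only [prob, ind_not, Finset.expect_sub_distrib, Fintype.expect_const]

lemma expect_fst [Fintype α] [Fintype β] [Nonempty β] (f : α → ℝ) :
    𝔼 x : α × β, f x.1 = 𝔼 a, f a := by
  rw [← Finset.univ_product_univ, Finset.expect_product]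
  exact Finset.expect_congr rfl fun a _ => Fintype.expect_const (f a)

lemma expect_snd [Fintype α] [Fintype β] [Nonempty α] (f : β → ℝ) :
    𝔼 x : α × β, f x.2 = 𝔼 b, f b := by
  rw [← expect_fst (β := α) f]
  exact Fintype.expect_equiv (Equiv.prodComm α β) _ _ fun x => rfl

/-- Functions of independent coordinates are independent. -/
lemma expect_prod_pi [Fintype ι] [DecidableEq ι] [Fintype α] (g : ι → α → ℝ) :
    𝔼 c : ι → α, ∏ i, g i (c i) = ∏ i, 𝔼 a, g i a := by
  simp only [Fintype.expect_eq_sum_div_card, Finset.prod_div_distrib, Finset.prod_const,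
    Fintype.card_pi, Finset.card_univ]
  rw [Finset.prod_univ_sum, Fintype.piFinset_univ]
  push_cast
  rfl

lemma expect_pi_fst [Fintype ι] [DecidableEq ι] [Fintype α] [Fintype β] [Nonempty β]
    (f : (ι → α) → ℝ) : 𝔼 c : ι → α × β, f (fun i => (c i).1) = 𝔼 a : ι → α, f a := by
  rw [← expect_fst (β := ι → β) f]
  exact Fintype.expect_equiv (Equiv.arrowProdEquivProdArrow ι (fun _ => α) fun _ => β) _ _
    fun c => rfl

/-- Independence of the columns of a uniformly random matrix. -/
lemma expect_prod_columns [Fintype ι] [DecidableEq ι] [Fintype κ] [DecidableEq κ] [Fintype α]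
    (F : (ι → α) → ℝ) :
    𝔼 a : ι → κ → α, ∏ k, F (fun i => a i k) = (𝔼 b, F b) ^ Fintype.card κ := by
  have h := expect_prod_pi (ι := κ) (α := ι → α) fun _ => F
  rw [Finset.prod_const, Finset.card_univ] at h
  rw [← h]
  exact Fintype.expect_equiv (Equiv.piComm fun (_ : ι) (_ : κ) => α) _ _ fun c => rfl

lemma ind_forall_mem [Fintype ι] [DecidableEq ι] (T : Finset ι) (P : ι → Prop) :
    ind (∀ i ∈ T, P i) = ∏ i, if i ∈ T then ind (P i) else 1 := by
  by_cases h : ∀ i ∈ T, P i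
  · rw [ind_of h, Finset.prod_eq_one]
    intro i _
    split_ifs with hi
    exacts [ind_of (h i hi), rfl]
  · push Not at h
    obtain ⟨i, hi, hP⟩ := h
    rw [ind_of_not fun h => hP (h i hi), Finset.prod_eq_zero (Finset.mem_univ i)]
    rw [if_pos hi, ind_of_not hP]

lemma prob_forall_mem [Fintype ι] [DecidableEq ι] [Fintype α] [Nonempty α] (T : Finset ι)
    (P : ι → α → Prop) :
    prob (fun c : ι → α => ∀ i ∈ T, P i (c i)) = ∏ i ∈ T, prob (P i) := by
  rw [prob]
  simp only [ind_forall_mem]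
  rw [expect_prod_pi fun i a => if i ∈ T then ind (P i a) else 1,
    ← Finset.prod_subset (Finset.subset_univ T)]
  · exact Finset.prod_congr rfl fun i hi => by simp only [if_pos hi]; rfl
  · intro i _ hi
    simp only [if_neg hi]
    exact Fintype.expect_const _

/-- The probability that `u` succeeds while all members of `T` fail. -/
lemma prob_and_forall_not [Fintype ι] [DecidableEq ι] [Fintype α] [Nonempty α] {T : Finset ι}
    {u : ι} (hu : u ∉ T) (P : ι → α → Prop) :
    prob (fun c : ι → α => P u (c u) ∧ ∀ i ∈ T, ¬ P i (c i)) =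
      prob (P u) * ∏ i ∈ T, (1 - prob (P i)) := by
  have h := prob_forall_mem (insert u T) fun i a => if i = u then P i a else ¬ P i a
  rw [Finset.prod_insert hu] at h
  simp only [if_true] at h
  rw [← show ∏ i ∈ T, prob (fun a => if i = u then P i a else ¬ P i a) =
    ∏ i ∈ T, (1 - prob (P i)) from Finset.prod_congr rfl fun i hi => by
      simp only [if_neg (ne_of_mem_of_not_mem hi hu)]; exact prob_not _, ← h]
  congr 1
  funext c
  simp only [Finset.mem_insert, forall_eq_or_imp, if_true]
  refine propext (and_congr_right fun _ => forall₂_congr fun i hi => ?_)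
  rw [if_neg (ne_of_mem_of_not_mem hi hu)]

/-- Resampling one coordinate does not change an expectation. -/
lemma expect_resample [Fintype ι] [DecidableEq ι] [Fintype α] [Nonempty α]
    (f : (ι → α) → ℝ) (i : ι) :
    𝔼 c : ι → α, f c = 𝔼 c : ι → α, 𝔼 a, f (Function.update c i a) := by
  rw [← Finset.expect_product', Finset.univ_product_univ, ← expect_fst (β := α) f]
  let e : (ι → α) × α → (ι → α) × α := fun x => (Function.update x.1 i x.2, x.1 i)
  have he : Function.Involutive e := fun x => by simp [e]
  exact (Fintype.expect_equiv he.toPerm _ _ fun x => rfl).symm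

/-- Weierstrass' product inequality. -/
lemma one_sub_sum_le_prod (T : Finset ι) {r : ι → ℝ} (h0 : ∀ i, 0 ≤ r i) (h1 : ∀ i, r i ≤ 1) :
    1 - ∑ i ∈ T, r i ≤ ∏ i ∈ T, (1 - r i) := by
  classical
  induction T using Finset.induction_on with
  | empty => simp
  | insert i T hi ih =>
    rw [Finset.sum_insert hi, Finset.prod_insert hi]
    have h2 : ∏ i ∈ T, (1 - r i) ≤ 1 :=
      Finset.prod_le_one (fun i _ => sub_nonneg.2 (h1 i)) fun i _ => by linarith [h0 i]
    nlinarith [h0 i, h1 i]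

lemma prod_one_sub_le_exp (T : Finset ι) {r : ι → ℝ} (h1 : ∀ i, r i ≤ 1) :
    ∏ i ∈ T, (1 - r i) ≤ Real.exp (-∑ i ∈ T, r i) := by
  rw [← Finset.sum_neg_distrib, Real.exp_sum]
  exact Finset.prod_le_prod (fun i _ => sub_nonneg.2 (h1 i)) fun i _ => by
    linarith [Real.add_one_le_exp (-r i)]

end FiniteProbability

/-! ### The coins of a round -/

section CoinProbabilities

open scoped BigOperators

variable {V : Type*} {I R : ℕ}

/-- A beeping probability that the coins realize exactly: `0`, or `1 / 2 ^ k` with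
`1 ≤ k ≤ R`. -/
def Dyadic (R : ℕ) (p : ℚ) : Prop := p = 0 ∨ ∃ k, 1 ≤ k ∧ k ≤ R ∧ p = (1 / 2) ^ k

lemma Dyadic.nonneg {p : ℚ} (h : Dyadic R p) : 0 ≤ (p : ℝ) := by
  obtain rfl | ⟨k, -, -, rfl⟩ := h
  · simp
  · push_cast; positivity

lemma Dyadic.le_half {p : ℚ} (h : Dyadic R p) : (p : ℝ) ≤ 1 / 2 := by
  obtain rfl | ⟨k, hk, -, rfl⟩ := h
  · norm_num
  · push_cast
    exact (pow_le_pow_of_le_one (by norm_num) (by norm_num) hk).trans (by norm_num)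

lemma prob_hits {p : ℚ} (h : Dyadic R p) : prob (fun U : Fin (2 ^ R) => hits U p = true) = p := by
  obtain rfl | ⟨k, -, hk, rfl⟩ := h
  · simp [prob, hits_zero, ind]
  · have hiff : ∀ U : Fin (2 ^ R), hits U ((1 / 2) ^ k) = true ↔ (U : ℕ) < 2 ^ (R - k) := by
      intro U
      rw [hits, decide_eq_true_iff, div_lt_iff₀ (by positivity), one_div, inv_pow,
        show ((2 : ℚ) ^ R) = 2 ^ (R - k) * 2 ^ k by rw [← pow_add, Nat.sub_add_cancel hk],
        mul_comm, mul_assoc, mul_inv_cancel₀ (by positivity), mul_one]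
      exact_mod_cast Iff.rfl
    have hcard : (Finset.univ.filter fun U : Fin (2 ^ R) => (U : ℕ) < 2 ^ (R - k)).card =
        2 ^ (R - k) := by
      rw [Fin.card_filter_val_lt]
      exact min_eq_right (Nat.pow_le_pow_right (by norm_num) (Nat.sub_le R k))
    simp only [prob, hiff, ind]
    rw [Fintype.expect_eq_sum_div_card, Finset.sum_boole]
    have h3 : ((2 : ℝ) ^ R) = 2 ^ (R - k) * 2 ^ k := by rw [← pow_add, Nat.sub_add_cancel hk]
    have h4 : (Fintype.card (Fin (2 ^ R)) : ℝ) = 2 ^ (R - k) * 2 ^ k := by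
      rw [Fintype.card_fin, ← h3]
      push_cast
      rfl
    have h5 : (2 : ℝ) ^ (R - k) ≠ 0 := by positivity
    rw [h4, one_div, inv_pow, div_eq_iff (by positivity)]
    push_cast
    rw [mul_left_comm, inv_mul_cancel₀ (by positivity), mul_one]
    exact_mod_cast (by convert hcard : (Finset.univ.filter
      fun U : Fin (2 ^ R) => (U : ℕ) < 2 ^ (R - k)).card = 2 ^ (R - k))

lemma prob_hits_mark {p : ℚ} (h : Dyadic R p) :
    prob (fun x : RoundCoins I R => hits x.2.2.1 p = true) = p := by
  rw [← prob_hits h, prob, prob]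
  rw [expect_snd (α := Fin I → Fin (2 ^ R))
      fun x : Bool × Fin (2 ^ R) × {S : Finset (Fin I) // S.card = I / 2} =>
        ind (hits x.2.1 p = true)]
  rw [expect_snd (α := Bool) fun x : Fin (2 ^ R) × {S : Finset (Fin I) // S.card = I / 2} =>
        ind (hits x.1 p = true)]
  have : Nonempty {S : Finset (Fin I) // S.card = I / 2} :=
    ⟨(Classical.arbitrary (RoundCoins I R)).2.2.2⟩
  exact expect_fst fun U : Fin (2 ^ R) => ind (hits U p = true)

variable [Fintype V] [DecidableEq V]

/-- The probability that `u` is marked while no member of `T` is. -/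
lemma prob_marks_alone {q : V → ℚ} (hq : ∀ u, Dyadic R (q u)) {u : V} {T : Finset V}
    (hu : u ∉ T) :
    prob (fun c : V → RoundCoins I R => Marks c q u ∧ ∀ w ∈ T, ¬ Marks c q w) =
      q u * ∏ w ∈ T, (1 - (q w : ℝ)) := by
  have h := prob_and_forall_not (α := RoundCoins I R) hu
    fun w x => hits x.2.2.1 (q w) = true
  simp only [prob_hits_mark (hq _)] at h
  exact h

lemma prob_marks_alone_ge {q : V → ℚ} (hq : ∀ u, Dyadic R (q u)) {u : V} {T : Finset V}
    (hu : u ∉ T) :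
    q u * (1 - ∑ w ∈ T, (q w : ℝ)) ≤
      prob (fun c : V → RoundCoins I R => Marks c q u ∧ ∀ w ∈ T, ¬ Marks c q w) := by
  rw [prob_marks_alone hq hu]
  refine mul_le_mul_of_nonneg_left (one_sub_sum_le_prod T (fun w => (hq w).nonneg) fun w => ?_)
    (hq u).nonneg
  linarith [(hq w).le_half]

/-- The probability that `u` is marked and has chosen the same slots as all marked nodes of `T`,
where there is at least one of them. The bound does not depend on the size of `T`: compare the
slots of `u` with those of one marked node of `T`, keeping all other coins fixed. -/
lemma prob_marks_same_slots_le {q : V → ℚ} (hq : ∀ u, Dyadic R (q u)) {u : V} {T : Finset V}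
    (hu : u ∉ T) :
    prob (fun c : V → RoundCoins I R => Marks c q u ∧ (∃ w ∈ T, Marks c q w) ∧
        ∀ w ∈ T, Marks c q w → (c w).2.2.2 = (c u).2.2.2) ≤
      q u * (1 / (I.choose (I / 2) : ℝ)) := by
  classical
  have : Nonempty {S : Finset (Fin I) // S.card = I / 2} :=
    ⟨(Classical.arbitrary (RoundCoins I R)).2.2.2⟩
  have hcard : Fintype.card {S : Finset (Fin I) // S.card = I / 2} = I.choose (I / 2) := by
    simp
  have hpos : (0 : ℝ) < (I.choose (I / 2) : ℝ) := by
    exact_mod_cast Nat.choose_pos (Nat.div_le_self I 2)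
  rw [prob, expect_resample _ u, ← Fintype.expect_const (ι := V → RoundCoins I R)
    ((q u : ℝ) * (1 / (I.choose (I / 2) : ℝ)))]
  refine expect_mono fun c => ?_
  have hne : ∀ w ∈ T, w ≠ u := fun w hw => ne_of_mem_of_not_mem hw hu
  have hupd : ∀ a, ∀ w ∈ T, Function.update c u a w = c w := fun a w hw =>
    Function.update_of_ne (hne w hw) a c
  by_cases hex : ∃ w ∈ T, Marks c q w
  · obtain ⟨w, hw, hm⟩ := hex
    calc 𝔼 a, ind (Marks (Function.update c u a) q u ∧
            (∃ w ∈ T, Marks (Function.update c u a) q w) ∧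
            ∀ w ∈ T, Marks (Function.update c u a) q w →
              (Function.update c u a w).2.2.2 = (Function.update c u a u).2.2.2)
        ≤ 𝔼 a : RoundCoins I R, ind (hits a.2.2.1 (q u) = true) * ind (a.2.2.2 = (c w).2.2.2) := by
          refine expect_mono fun a => ?_
          rw [← ind_and]
          refine ind_mono ?_
          rintro ⟨h1, -, h2⟩
          have h3 := h2 w hw (by rw [Marks, hupd a w hw]; exact hm)
          rw [hupd a w hw, Function.update_self] at h3
          rw [Marks, Function.update_self] at h1
          exact ⟨h1, h3.symm⟩
      _ = q u * (1 / (I.choose (I / 2) : ℝ)) := by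
          rw [expect_snd (α := Fin I → Fin (2 ^ R))
              fun x : Bool × Fin (2 ^ R) × {S : Finset (Fin I) // S.card = I / 2} =>
                ind (hits x.2.1 (q u) = true) * ind (x.2.2 = (c w).2.2.2),
            expect_snd (α := Bool)
              fun x : Fin (2 ^ R) × {S : Finset (Fin I) // S.card = I / 2} =>
                ind (hits x.1 (q u) = true) * ind (x.2 = (c w).2.2.2),
            ← Finset.univ_product_univ, Finset.expect_product]
          dsimp only
          simp only [← Finset.mul_expect, ← Finset.expect_mul]
          congr 1
          · exact prob_hits (hq u)
          · rw [Fintype.expect_eq_sum_div_card, hcard, Finset.sum_eq_single (c w).2.2.2, ind_of rfl]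
            · exact fun S _ hS => ind_of_not hS
            · exact fun h => absurd (Finset.mem_univ _) h
  · refine le_trans (le_of_eq ?_) (mul_nonneg (hq u).nonneg (by positivity))
    refine Finset.expect_eq_zero fun a _ => ind_of_not ?_
    rintro ⟨-, ⟨w, hw, hm⟩, -⟩
    rw [Marks, hupd a w hw] at hm
    exact hex ⟨w, hw, hm⟩

end CoinProbabilities

/-! ### The estimates of the effective degree -/

section Estimates

open scoped BigOperators

variable {V : Type*} {I R : ℕ} {G : SimpleGraph V} {q : V → ℚ}

open Classical in
/-- The weight of a slot of the first interval for node `u`: `x₀` if `u` beeps, `x₁` if it hears a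
beep, and `x₂` if it hears nothing. -/
noncomputable def slotWeight (G : SimpleGraph V) (q : V → ℚ) (u : V) (x₀ x₁ x₂ : ℝ)
    (a : V → Fin (2 ^ R)) : ℝ :=
  if hits (a u) (q u) = true then x₀
  else if ∃ w, G.Adj u w ∧ hits (a w) (q w) = true then x₁ else x₂

open Classical in
/-- The number of slots of the first interval in which `u` listens and hears nothing. -/
noncomputable def silentCount (G : SimpleGraph V) (c : V → RoundCoins I R) (q : V → ℚ) (u : V) :
    ℕ :=
  (Finset.univ.filter fun i => ¬ Signals c q u i ∧ ¬ ∃ w, G.Adj u w ∧ Signals c q w i).card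

lemma heardCount_add_silentCount (c : V → RoundCoins I R) (u : V) :
    heardCount G c q u + silentCount G c q u = listenCount c q u := by
  classical
  rw [heardCount, silentCount, listenCount, ← Finset.filter_filter, ← Finset.filter_filter]
  exact Finset.card_filter_add_card_filter_not _

variable [Fintype V]

open Classical in
/-- The expected number of beeps that node `u` is exposed to in a slot, its effective degree. -/
noncomputable def effDegree (G : SimpleGraph V) (q : V → ℚ) (u : V) : ℝ :=
  ∑ w ∈ Finset.univ.filter (G.Adj u), (q w : ℝ)

open Classical in
/-- The probability that no neighbor of `u` beeps in a slot. -/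
noncomputable def silence (G : SimpleGraph V) (q : V → ℚ) (u : V) : ℝ :=
  ∏ w ∈ Finset.univ.filter (G.Adj u), (1 - (q w : ℝ))

lemma one_sub_effDegree_le_silence (hq : ∀ u, Dyadic R (q u)) (u : V) :
    1 - effDegree G q u ≤ silence G q u :=
  one_sub_sum_le_prod _ (fun w => (hq w).nonneg) fun w => by linarith [(hq w).le_half]

lemma silence_le (hq : ∀ u, Dyadic R (q u)) {u : V} (hu : 3 / 10 ≤ effDegree G q u) :
    silence G q u ≤ 3 / 4 := by
  refine (prod_one_sub_le_exp _ fun w => by linarith [(hq w).le_half]).trans ?_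
  rw [Real.exp_neg, inv_le_comm₀ (Real.exp_pos _) (by norm_num)]
  change _ ≤ Real.exp (effDegree G q u)
  nlinarith [Real.quadratic_le_exp_of_nonneg (show 0 ≤ effDegree G q u by linarith)]

lemma prod_slotWeight (c : V → RoundCoins I R) (u : V) (x₀ x₁ x₂ : ℝ) :
    ∏ i, slotWeight G q u x₀ x₁ x₂ (fun w => (c w).1 i) =
      x₀ ^ (I - listenCount c q u) * (x₁ ^ heardCount G c q u * x₂ ^ silentCount G c q u) := by
  classical
  have h : (Finset.univ.filter fun i => Signals c q u i).card = I - listenCount c q u := by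
    have := Finset.card_filter_add_card_filter_not (s := (Finset.univ : Finset (Fin I)))
      fun i => Signals c q u i
    rw [Finset.card_univ, Fintype.card_fin] at this
    rw [listenCount]
    omega
  have h' : ∀ i, slotWeight G q u x₀ x₁ x₂ (fun w => (c w).1 i) = if Signals c q u i then x₀ else
      if ∃ w, G.Adj u w ∧ Signals c q w i then x₁ else x₂ := fun i => by
    unfold slotWeight Signals
    congr
  simp only [h']
  rw [Finset.prod_ite, Finset.prod_ite, Finset.prod_const, Finset.prod_const, Finset.prod_const, h,
    Finset.filter_filter, Finset.filter_filter, heardCount, silentCount]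
  congr!

variable [DecidableEq V]

lemma expect_slotWeight (hq : ∀ u, Dyadic R (q u)) (u : V) (x₀ x₁ x₂ : ℝ) :
    𝔼 a : V → Fin (2 ^ R), slotWeight G q u x₀ x₁ x₂ a =
      x₀ + (1 - q u) * ((x₁ - x₀) + (x₂ - x₁) * silence G q u) := by
  classical
  have hu : u ∉ Finset.univ.filter (G.Adj u) := by simp
  have h1 : prob (fun a : V → Fin (2 ^ R) => ¬ hits (a u) (q u) = true) = 1 - q u := by
    have := prob_forall_mem (α := Fin (2 ^ R)) {u} fun w x => ¬ hits x (q w) = true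
    simp only [Finset.mem_singleton, forall_eq, Finset.prod_singleton] at this
    rw [this, prob_not, prob_hits (hq u)]
  have h2 : prob (fun a : V → Fin (2 ^ R) => ∀ w ∈ insert u (Finset.univ.filter (G.Adj u)),
      ¬ hits (a w) (q w) = true) = (1 - q u) * silence G q u := by
    rw [prob_forall_mem (α := Fin (2 ^ R)) _ fun w x => ¬ hits x (q w) = true,
      Finset.prod_insert hu, prob_not, prob_hits (hq u), silence]
    simp only [prob_not, prob_hits (hq _)]
  have h3 : ∀ a : V → Fin (2 ^ R), slotWeight G q u x₀ x₁ x₂ a = x₀ +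
      ((x₁ - x₀) * ind (¬ hits (a u) (q u) = true) + (x₂ - x₁) *
        ind (∀ w ∈ insert u (Finset.univ.filter (G.Adj u)), ¬ hits (a w) (q w) = true)) := by
    intro a
    rw [slotWeight]
    simp only [Finset.mem_insert, Finset.mem_filter, Finset.mem_univ, true_and, forall_eq_or_imp,
      ind_and]
    by_cases ha : hits (a u) (q u) = true
    · rw [if_pos ha, ind_of_not (not_not.2 ha)]; ring
    · rw [if_neg ha, ind_of ha]
      by_cases hw : ∃ w, G.Adj u w ∧ hits (a w) (q w) = true
      · rw [if_pos hw, ind_of_not (by push Not; exact hw)]; ring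
      · rw [if_neg hw, ind_of (by push Not at hw; push Not; exact hw)]; ring
  simp only [h3, Finset.expect_add_distrib, Fintype.expect_const, ← Finset.mul_expect]
  rw [← prob, ← prob, h1, h2]
  ring

/-- Chernoff's method for the slots of the first interval. -/
lemma prob_le_pow_of_slotWeight (u : V) {x₀ x₁ x₂ ρ : ℝ} (h0 : 0 ≤ x₀) (h1 : 0 ≤ x₁)
    (h2 : 0 ≤ x₂) (hρ : 𝔼 a : V → Fin (2 ^ R), slotWeight G q u x₀ x₁ x₂ a ≤ ρ)
    {P : (V → RoundCoins I R) → Prop}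
    (hP : ∀ c, P c → 1 ≤ ∏ i, slotWeight G q u x₀ x₁ x₂ fun w => (c w).1 i) :
    prob P ≤ ρ ^ I := by
  have hnn : ∀ a : V → Fin (2 ^ R), 0 ≤ slotWeight G q u x₀ x₁ x₂ a := by
    intro a
    rw [slotWeight]
    split_ifs <;> assumption
  have : Nonempty {S : Finset (Fin I) // S.card = I / 2} :=
    ⟨(Classical.arbitrary (RoundCoins I R)).2.2.2⟩
  calc prob P ≤ 𝔼 c : V → RoundCoins I R, ∏ i, slotWeight G q u x₀ x₁ x₂ fun w => (c w).1 i := by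
        refine expect_mono fun c => ?_
        by_cases h : P c
        · rw [ind_of h]; exact hP c h
        · rw [ind_of_not h]; exact Finset.prod_nonneg fun i _ => hnn _
    _ = (𝔼 a : V → Fin (2 ^ R), slotWeight G q u x₀ x₁ x₂ a) ^ I := by
        rw [expect_pi_fst fun b : V → Fin I → Fin (2 ^ R) =>
          ∏ i, slotWeight G q u x₀ x₁ x₂ fun w => b w i, expect_prod_columns, Fintype.card_fin]
    _ ≤ ρ ^ I := pow_le_pow_left₀ (Finset.expect_nonneg fun a _ => hnn a) hρ I

/-- A node almost surely listens in more than a third of the slots. -/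
lemma prob_listenCount_le (hq : ∀ u, Dyadic R (q u)) (u : V) :
    prob (fun c : V → RoundCoins I R => (listenCount c q u : ℚ) ≤ (I : ℚ) / 3) ≤
      (997 / 1000) ^ I := by
  -- the product of the weights is `1.25 ^ (I - 3 * listen)`; the graph is irrelevant as `x₁ = x₂`
  refine prob_le_pow_of_slotWeight (G := (⊥ : SimpleGraph V)) (q := q) u (x₀ := 5 / 4) (x₁ := 16 / 25)
    (x₂ := 16 / 25) (by norm_num) (by norm_num) (by norm_num) ?_ fun c hc => ?_
  · rw [expect_slotWeight hq]
    nlinarith [(hq u).le_half]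
  · have h1 : 3 * listenCount c q u ≤ I := by
      rw [le_div_iff₀ (by norm_num)] at hc
      have : listenCount c q u * 3 ≤ I := by exact_mod_cast hc
      omega
    obtain ⟨m, hm⟩ := Nat.exists_eq_add_of_le h1
    rw [prod_slotWeight, ← pow_add, heardCount_add_silentCount,
      show I - listenCount c q u = 2 * listenCount c q u + m by omega, pow_add, pow_mul,
      mul_right_comm, ← mul_pow]
    norm_num
    exact one_le_pow₀ (by norm_num)

lemma prob_high_le (hq : ∀ u, Dyadic R (q u)) {u : V} (hu : effDegree G q u ≤ 15 / 100) :
    prob (fun c : V → RoundCoins I R => High G c q u) ≤ 2 * (997 / 1000) ^ I := by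
  have h : prob (fun c : V → RoundCoins I R =>
      silentCount G c q u ≤ 4 * heardCount G c q u) ≤ (997 / 1000) ^ I := by
    -- the product of the weights is `1.1 ^ (4 * heard - silent)`
    refine prob_le_pow_of_slotWeight (G := G) (q := q) u (x₀ := 1) (x₁ := (11 / 10) ^ 4)
      (x₂ := 10 / 11) (by norm_num) (by norm_num) (by norm_num) ?_ fun c hc => ?_
    · rw [expect_slotWeight hq]
      have h1 := one_sub_effDegree_le_silence (G := G) hq u
      nlinarith [(hq u).le_half]
    · obtain ⟨m, hm⟩ := Nat.exists_eq_add_of_le hc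
      rw [prod_slotWeight, ← pow_mul, hm, pow_add, one_pow, one_mul,
        mul_right_comm, ← mul_pow]
      norm_num
      exact one_le_pow₀ (by norm_num)
  refine le_trans (prob_mono (Q := fun c => (listenCount c q u : ℚ) ≤ (I : ℚ) / 3 ∨
    silentCount G c q u ≤ 4 * heardCount G c q u) fun c hc => ?_) ((prob_or_le _ _).trans ?_)
  · rw [High] at hc
    split_ifs at hc with h1
    · exact .inl h1
    · right
      have hpos : (0 : ℚ) < listenCount c q u := lt_of_le_of_lt (by positivity) (not_le.1 h1)
      rw [gt_iff_lt, lt_div_iff₀ hpos, ← heardCount_add_silentCount (G := G)] at hc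
      push_cast at hc
      have : (silentCount G c q u : ℚ) ≤ 4 * heardCount G c q u := by linarith
      exact_mod_cast this
  · rw [two_mul]
    exact add_le_add (prob_listenCount_le hq u) h

lemma prob_not_high_le (hq : ∀ u, Dyadic R (q u)) {u : V} (hu : 3 / 10 ≤ effDegree G q u) :
    prob (fun c : V → RoundCoins I R => ¬ High G c q u) ≤ 2 * (997 / 1000) ^ I := by
  have h : prob (fun c : V → RoundCoins I R =>
      4 * heardCount G c q u ≤ silentCount G c q u) ≤ (997 / 1000) ^ I := by
    -- the product of the weights is `1.06 ^ (silent - 4 * heard)`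
    refine prob_le_pow_of_slotWeight (G := G) (q := q) u (x₀ := 1) (x₁ := (100 / 106) ^ 4)
      (x₂ := 106 / 100) (by norm_num) (by norm_num) (by norm_num) ?_ fun c hc => ?_
    · rw [expect_slotWeight hq]
      have h1 := silence_le hq hu
      nlinarith [(hq u).le_half]
    · obtain ⟨m, hm⟩ := Nat.exists_eq_add_of_le hc
      rw [prod_slotWeight, ← pow_mul, hm, pow_add, one_pow, one_mul, ← mul_assoc, ← mul_pow]
      norm_num
      exact one_le_pow₀ (by norm_num)
  refine le_trans (prob_mono (Q := fun c => (listenCount c q u : ℚ) ≤ (I : ℚ) / 3 ∨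
    4 * heardCount G c q u ≤ silentCount G c q u) fun c hc => ?_) ((prob_or_le _ _).trans ?_)
  · rw [High] at hc
    split_ifs at hc with h1
    · exact .inl h1
    · right
      have hpos : (0 : ℚ) < listenCount c q u := lt_of_le_of_lt (by positivity) (not_le.1 h1)
      rw [not_lt, div_le_iff₀ hpos, ← heardCount_add_silentCount (G := G)] at hc
      push_cast at hc
      have : (4 * heardCount G c q u : ℚ) ≤ silentCount G c q u := by linarith
      exact_mod_cast this
  · rw [two_mul]
    exact add_le_add (prob_listenCount_le hq u) h

end Estimates

/-! ### One round: effective degrees and termination -/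

section Transition

open scoped BigOperators

variable {V : Type*} {I R : ℕ} {G : SimpleGraph V} {q : V → ℚ}

lemma edist_le_one_of_adj {v u : V} (h : G.Adj v u) : G.edist v u ≤ 1 := by
  simpa using (SimpleGraph.Walk.cons h SimpleGraph.Walk.nil).edist_le

lemma edist_le_two_of_adj_adj {v u w : V} (h : G.Adj v u) (h' : G.Adj u w) : G.edist v w ≤ 2 := by
  simpa using (SimpleGraph.Walk.cons h (SimpleGraph.Walk.cons h' SimpleGraph.Walk.nil)).edist_le

lemma High.congr {c c' : V → RoundCoins I R} {u : V} (hu : c u = c' u)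
    (hw : ∀ w, G.Adj u w → c w = c' w) (h : High G c q u) : High G c' q u := by
  have hs : ∀ w, w = u ∨ G.Adj u w → ∀ i, Signals c q w i ↔ Signals c' q w i := by
    rintro w (rfl | h) i
    · rw [Signals, Signals, hu]
    · rw [Signals, Signals, hw w h]
  have h1 : listenCount c q u = listenCount c' q u := by
    classical
    exact congrArg Finset.card (Finset.filter_congr fun i _ => not_congr (hs u (.inl rfl) i))
  have h2 : heardCount G c q u = heardCount G c' q u := by
    classical
    exact congrArg Finset.card (Finset.filter_congr fun i _ =>
      and_congr (not_congr (hs u (.inl rfl) i)) (exists_congr fun w => and_congr_right fun h =>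
        hs w (.inr h) i))
  rw [High] at h ⊢
  rwa [← h1, ← h2, ← hu]

/-- Coins `c'` coincide with the random coins `c` in the 2-hop neighborhood of `v`. -/
def AgreeNear (G : SimpleGraph V) (v : V) (c c' : V → RoundCoins I R) : Prop :=
  ∀ u, G.edist v u ≤ 2 → c' u = c u

lemma AgreeNear.self {v : V} {c c' : V → RoundCoins I R} (h : AgreeNear G v c c') :
    c' v = c v := h v (by simp)

lemma AgreeNear.neighbor {v u : V} {c c' : V → RoundCoins I R} (h : AgreeNear G v c c')
    (hu : G.Adj v u) : c' u = c u := h u ((edist_le_one_of_adj hu).trans (by norm_num))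

lemma AgreeNear.neighbor₂ {v u w : V} {c c' : V → RoundCoins I R} (h : AgreeNear G v c c')
    (hu : G.Adj v u) (hw : G.Adj u w) : c' w = c w := h w (edist_le_two_of_adj_adj hu hw)

lemma AgreeNear.high_self {v : V} {c c' : V → RoundCoins I R} (h : AgreeNear G v c c') :
    High G c' q v ↔ High G c q v :=
  ⟨High.congr h.self fun _ hw => h.neighbor hw,
    High.congr h.self.symm fun _ hw => (h.neighbor hw).symm⟩

lemma AgreeNear.high_neighbor {v u : V} {c c' : V → RoundCoins I R} (h : AgreeNear G v c c')
    (hu : G.Adj v u) : High G c' q u ↔ High G c q u :=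
  ⟨High.congr (h.neighbor hu) fun _ hw => h.neighbor₂ hu hw,
    High.congr (h.neighbor hu).symm fun _ hw => (h.neighbor₂ hu hw).symm⟩

lemma joins_of_alone {c : V → RoundCoins I R} {u : V} (h : Marks c q u)
    (h' : ∀ w, G.Adj u w → ¬ Marks c q w) : Joins G c q u :=
  ⟨h, fun w hw hm => absurd hm (h' w hw)⟩

lemma nextWeight_le {c : V → RoundCoins I R} {u : V} (hq : 0 ≤ q u) :
    nextWeight G c q u ≤ 2 * q u := by
  rw [nextWeight]
  split_ifs
  · linarith
  · exact min_le_left _ _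

lemma half_le_nextWeight {c : V → RoundCoins I R} {u : V} (hq : 0 ≤ q u) (hq' : q u ≤ 1 / 2) :
    q u / 2 ≤ nextWeight G c q u := by
  rw [nextWeight]
  split_ifs
  · exact le_rfl
  · exact le_min (by linarith) (by linarith)

/-- The beeping probability of `u` in the round after a round with coins `c`. -/
noncomputable def weightAfter (G : SimpleGraph V) (c : V → RoundCoins I R) (σ : V → NodeState)
    (u : V) : ℝ :=
  (weight (slots G c σ (2 * I + 1) u) : ℝ)

variable {σ : V → NodeState}

lemma weightAfter_of_terminated {c : V → RoundCoins I R} {u : V}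
    (h : (slots G c σ (2 * I + 1) u).terminated = true) : weightAfter G c σ u = 0 := by
  rw [weightAfter, weight_of_terminated h, Rat.cast_zero]

lemma weightAfter_of_active (hI : 0 < I) (hσ : ∀ u, Fresh (σ u)) {c : V → RoundCoins I R} {u : V}
    (h : (slots G c σ (2 * I + 1) u).terminated = false) :
    weightAfter G c σ u = (nextWeight G c (weights σ) u : ℝ) := by
  rw [weightAfter, weight_of_active h, slots_last hI hσ h]

/-- The states that can occur at the beginning of a round in which the coins realize all beeping
probabilities exactly. -/
structure Regular (R : ℕ) (σ : V → NodeState) : Prop where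
  fresh : ∀ u, Fresh (σ u)
  dyadic : ∀ u, Dyadic R (weights σ u)
  pos : ∀ u, (σ u).terminated = false → 0 < weights σ u

lemma Regular.nonneg (h : Regular R σ) (u : V) : 0 ≤ (weights σ u : ℝ) := (h.dyadic u).nonneg

lemma Regular.nonneg' (h : Regular R σ) (u : V) : 0 ≤ weights σ u := by
  exact_mod_cast h.nonneg u

lemma weightAfter_nonneg (hI : 0 < I) (hσ : Regular R σ) (c : V → RoundCoins I R) (u : V) :
    0 ≤ weightAfter G c σ u := by
  rcases h : (slots G c σ (2 * I + 1) u).terminated with _ | _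
  · rw [weightAfter_of_active hI hσ.fresh h]
    have h1 := half_le_nextWeight (G := G) (c := c) (hσ.nonneg' u) (by
      have h2 := (hσ.dyadic u).le_half
      have : ((weights σ u : ℚ) : ℝ) ≤ ((1 / 2 : ℚ) : ℝ) := by push_cast; linarith
      exact_mod_cast this)
    have := hσ.nonneg' u
    exact_mod_cast (by linarith : (0 : ℚ) ≤ nextWeight G c (weights σ) u)
  · rw [weightAfter_of_terminated h]

lemma weightAfter_le (hI : 0 < I) (hσ : Regular R σ) (c : V → RoundCoins I R) (u : V) :
    weightAfter G c σ u ≤ 2 * weights σ u := by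
  rcases h : (slots G c σ (2 * I + 1) u).terminated with _ | _
  · rw [weightAfter_of_active hI hσ.fresh h]
    exact_mod_cast nextWeight_le (hσ.nonneg' u)
  · rw [weightAfter_of_terminated h]
    linarith [hσ.nonneg u]

lemma weightAfter_le_of_high (hI : 0 < I) (hσ : Regular R σ) (c : V → RoundCoins I R) (u : V) :
    weightAfter G c σ u ≤
      weights σ u / 2 + 3 / 2 * weights σ u * ind (¬ High G c (weights σ) u) := by
  by_cases hh : High G c (weights σ) u
  · rw [ind_of_not (not_not.2 hh), mul_zero, add_zero]
    rcases h : (slots G c σ (2 * I + 1) u).terminated with _ | _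
    · rw [weightAfter_of_active hI hσ.fresh h, nextWeight, if_pos hh]
      push_cast
      exact le_rfl
    · rw [weightAfter_of_terminated h]
      linarith [hσ.nonneg u]
  · rw [ind_of hh]
    linarith [weightAfter_le (G := G) hI hσ c u]

variable [Fintype V]

/-- The effective degree of `v` in the round after a round with coins `c`. -/
noncomputable def effDegreeAfter (G : SimpleGraph V) (c : V → RoundCoins I R) (σ : V → NodeState)
    (v : V) : ℝ :=
  effDegree G (weights (slots G c σ (2 * I + 1))) v

lemma effDegreeAfter_eq (c : V → RoundCoins I R) (v : V) [DecidablePred (G.Adj v)] :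
    effDegreeAfter G c σ v = ∑ u ∈ Finset.univ.filter (G.Adj v), weightAfter G c σ u := by
  rw [effDegreeAfter, effDegree]
  congr!

lemma effDegreeAfter_nonneg (hI : 0 < I) (hσ : Regular R σ) (c : V → RoundCoins I R) (v : V) :
    0 ≤ effDegreeAfter G c σ v := by
  classical
  rw [effDegreeAfter_eq]
  exact Finset.sum_nonneg fun u _ => weightAfter_nonneg hI hσ c u

lemma effDegreeAfter_le (hI : 0 < I) (hσ : Regular R σ) (c : V → RoundCoins I R) (v : V) :
    effDegreeAfter G c σ v ≤ 2 * effDegree G (weights σ) v := by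
  classical
  rw [effDegreeAfter_eq, effDegree, Finset.mul_sum]
  exact Finset.sum_le_sum fun u _ => weightAfter_le hI hσ c u

lemma Regular.effDegree_nonneg (hσ : Regular R σ) (v : V) : 0 ≤ effDegree G (weights σ) v :=
  Finset.sum_nonneg fun u _ => hσ.nonneg u

open Classical in
/-- The part of the effective degree of `v` that is contributed by neighbors whose own effective
degree is low. -/
noncomputable def lowDegree (G : SimpleGraph V) (q : V → ℚ) (v : V) : ℝ :=
  ∑ u ∈ Finset.univ.filter (fun u => G.Adj v u ∧ effDegree G q u < 3 / 10), (q u : ℝ)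

/-- The interval has `I > 0` slots, enough for each estimate to err with probability at most
`10⁻⁶`: twice the Chernoff bound, once for the event that the node hardly listens and once for a
wrong fraction of heard beeps. -/
def LongInterval (I : ℕ) : Prop := 0 < I ∧ (2 : ℝ) * (997 / 1000) ^ I ≤ 1 / 1000000

variable [DecidableEq V] {v : V} {F : (V → RoundCoins I R) → V → RoundCoins I R}

lemma expect_weightAfter_le (hI : LongInterval I) (hσ : Regular R σ) {u : V}
    (hF : ∀ c, High G (F c) (weights σ) u ↔ High G c (weights σ) u)
    (hu : 3 / 10 ≤ effDegree G (weights σ) u) :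
    𝔼 c : V → RoundCoins I R, weightAfter G (F c) σ u ≤ 51 / 100 * weights σ u := by
  have h1 := (prob_not_high_le (I := I) hσ.dyadic hu).trans hI.2
  calc 𝔼 c : V → RoundCoins I R, weightAfter G (F c) σ u
      ≤ 𝔼 c : V → RoundCoins I R, ((weights σ u : ℝ) / 2 +
          3 / 2 * weights σ u * ind (¬ High G c (weights σ) u)) := by
        refine expect_mono fun c => ?_
        rw [← hF c]
        exact weightAfter_le_of_high hI.1 hσ _ u
    _ = weights σ u / 2 + 3 / 2 * weights σ u *
          prob (fun c : V → RoundCoins I R => ¬ High G c (weights σ) u) := by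
        rw [Finset.expect_add_distrib, Fintype.expect_const, ← Finset.mul_expect, prob]
    _ ≤ 51 / 100 * weights σ u := by nlinarith [hσ.nonneg u]

/-- The effective degree of `v` shrinks in expectation, except for the contribution of neighbors
with low effective degree. -/
lemma expect_effDegreeAfter_le (hI : LongInterval I) (hσ : Regular R σ)
    (hF : ∀ c, AgreeNear G v c (F c)) :
    𝔼 c : V → RoundCoins I R, effDegreeAfter G (F c) σ v ≤
      51 / 100 * effDegree G (weights σ) v + 149 / 100 * lowDegree G (weights σ) v := by
  classical
  simp only [effDegreeAfter_eq]
  rw [Finset.expect_sum_comm, effDegree, lowDegree, ← Finset.filter_filter, Finset.sum_filter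
    (fun u => effDegree G (weights σ) u < 3 / 10), Finset.mul_sum, Finset.mul_sum,
    ← Finset.sum_add_distrib]
  refine Finset.sum_le_sum fun u hu => ?_
  rw [Finset.mem_filter] at hu
  split_ifs with h
  · calc _ ≤ 𝔼 c : V → RoundCoins I R, 2 * (weights σ u : ℝ) :=
          expect_mono fun c => weightAfter_le hI.1 hσ _ u
      _ = 2 * (weights σ u : ℝ) := Fintype.expect_const _
      _ ≤ _ := by linarith
  · rw [mul_zero, add_zero]
    exact expect_weightAfter_le hI hσ (fun c => (hF c).high_neighbor hu.2) (not_lt.1 h)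

/-- The event that `v` terminates in the round. -/
def Ends (G : SimpleGraph V) (c : V → RoundCoins I R) (σ : V → NodeState) (v : V) : Prop :=
  (slots G c σ (2 * I + 1) v).terminated = true

lemma le_prob_ends (hI : LongInterval I) (hσ : Regular R σ) (hF : ∀ c, AgreeNear G v c (F c)) :
    weights σ v * (1 - effDegree G (weights σ) v) ≤ prob (fun c => Ends G (F c) σ v) := by
  classical
  refine (prob_marks_alone_ge (I := I) hσ.dyadic (u := v) (T := Finset.univ.filter (G.Adj v))
    (by simp)).trans (prob_mono fun c hc => ?_)
  refine terminated_of_joins hI.1 hσ.fresh (joins_of_alone ?_ fun w hw => ?_) (.inl rfl)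
  · rw [Marks, (hF c).self]
    exact hc.1
  · rw [Marks, (hF c).neighbor hw]
    exact hc.2 w (by simp [hw])

/-- A set of small numbers with a large sum has a subset whose sum is neither small nor large. -/
lemma exists_subset_sum {ι : Type*} [DecidableEq ι] {f : ι → ℝ} (hf : ∀ i, f i ≤ 1 / 2) {a : ℝ}
    (ha : 0 < a) (S : Finset ι) (hS : a ≤ ∑ i ∈ S, f i) :
    ∃ T ⊆ S, a ≤ ∑ i ∈ T, f i ∧ ∑ i ∈ T, f i ≤ a + 1 / 2 := by
  induction S using Finset.induction_on with
  | empty => simp only [Finset.sum_empty] at hS; linarith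
  | insert i S hi ih =>
    by_cases h : a ≤ ∑ i ∈ S, f i
    · obtain ⟨T, hT, h1⟩ := ih h
      exact ⟨T, hT.trans (Finset.subset_insert i S), h1⟩
    · refine ⟨insert i S, subset_rfl, hS, ?_⟩
      rw [Finset.sum_insert hi]
      linarith [hf i]

/-- If many neighbors of `v` have a low effective degree, then one of them joins with constant
probability: in a suitable subset of them, the events that a given node is the only marked one
among its neighbors and in the subset exclude each other. -/
lemma le_prob_ends_of_lowDegree (hI : LongInterval I) (hσ : Regular R σ)
    (hF : ∀ c, AgreeNear G v c (F c)) (hv : 1 / 100 ≤ lowDegree G (weights σ) v) :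
    19 / 10000 ≤ prob (fun c => Ends G (F c) σ v) := by
  classical
  obtain ⟨T, hTS, hT1, hT2⟩ := exists_subset_sum (fun u => (hσ.dyadic u).le_half)
    (by norm_num : (0 : ℝ) < 1 / 100) _ hv
  have hT : ∀ u ∈ T, G.Adj v u ∧ effDegree G (weights σ) u < 3 / 10 := fun u hu => by
    simpa using hTS hu
  let E : V → (V → RoundCoins I R) → Prop := fun u c => Marks c (weights σ) u ∧
    ∀ w ∈ (Finset.univ.filter (G.Adj u) ∪ T).erase u, ¬ Marks c (weights σ) w
  have hE : ∀ u ∈ T, 19 / 100 * (weights σ u : ℝ) ≤ prob (E u) := by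
    intro u hu
    refine le_trans ?_ (prob_marks_alone_ge hσ.dyadic (Finset.notMem_erase u _))
    have h1 : ∑ w ∈ (Finset.univ.filter (G.Adj u) ∪ T).erase u, (weights σ w : ℝ) ≤
        effDegree G (weights σ) u + ∑ w ∈ T, (weights σ w : ℝ) := by
      refine (Finset.sum_le_sum_of_subset_of_nonneg (Finset.erase_subset u _)
        fun w _ _ => hσ.nonneg w).trans ?_
      rw [effDegree, ← Finset.sum_union_inter]
      have : 0 ≤ ∑ w ∈ Finset.univ.filter (G.Adj u) ∩ T, (weights σ w : ℝ) :=
        Finset.sum_nonneg fun w _ => hσ.nonneg w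
      linarith
    have h2 := (hT u hu).2
    nlinarith [hσ.nonneg u]
  have hsub : ∀ c, ∑ u ∈ T, ind (E u c) ≤ ind (Ends G (F c) σ v) := by
    intro c
    by_cases hex : ∃ u ∈ T, E u c
    · obtain ⟨u, hu, huE⟩ := hex
      have hadj := (hT u hu).1
      have hj : Joins G (F c) (weights σ) u := by
        refine joins_of_alone ?_ fun w hw => ?_
        · rw [Marks, (hF c).neighbor hadj]
          exact huE.1
        · rw [Marks, (hF c).neighbor₂ hadj hw]
          exact huE.2 w (by simp [hw, hw.ne'])
      have hends : Ends G (F c) σ v := terminated_of_joins hI.1 hσ.fresh hj (.inr hadj)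
      rw [ind_of hends, Finset.sum_eq_single u, ind_of huE]
      · intro w hw hwu
        refine ind_of_not fun hwE => huE.2 w ?_ hwE.1
        simp [hw, hwu]
      · exact fun h => absurd hu h
    · rw [Finset.sum_eq_zero]
      · exact ind_nonneg _
      · intro u hu
        exact ind_of_not fun h => hex ⟨u, hu, h⟩
  calc (19 / 10000 : ℝ) ≤ 19 / 100 * ∑ u ∈ T, (weights σ u : ℝ) := by linarith
    _ ≤ ∑ u ∈ T, prob (E u) := by
        rw [Finset.mul_sum]
        exact Finset.sum_le_sum hE
    _ = 𝔼 c, ∑ u ∈ T, ind (E u c) := (Finset.expect_sum_comm _ _ _).symm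
    _ ≤ _ := expect_mono hsub

end Transition

/-! ### One round: the potentials -/

section Potential

open scoped BigOperators

/-- The potential of an active node with beeping probability `p` and effective degree `d`. The
exponents are so small that the chance of termination outweighs any increase in one round; the
second one is seven times the first, so that the halving of `p` is outweighed whenever `d + 1 / 5`
shrinks by a sixth. -/
noncomputable def potential (p d : ℝ) : ℝ := p ^ (-(1 / 5000) : ℝ) * (d + 1 / 5) ^ (7 / 5000 : ℝ)

lemma potential_nonneg {p d : ℝ} (hp : 0 < p) (hd : 0 ≤ d) : 0 ≤ potential p d := by
  unfold potential
  positivity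

lemma rpow_two_mul_le {y y' : ℝ} (hy : 0 < y) (hy' : 0 ≤ y') (h : y' ≤ 2 * y) {a : ℝ} (ha : 0 ≤ a) :
    y' ^ a ≤ y ^ a * 2 ^ a := by
  rw [← Real.mul_rpow hy.le (by norm_num), mul_comm y]
  exact Real.rpow_le_rpow hy' h ha

/-- Bernoulli's inequality for the growth of the second factor of the potential. -/
lemma rpow_le_linear {y y' : ℝ} (hy : 0 < y) (hy' : 0 ≤ y') :
    y' ^ (7 / 5000 : ℝ) ≤ y ^ (7 / 5000 : ℝ) * (1 + 7 / 5000 * ((y' - y) / y)) := by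
  have h := rpow_one_add_le_one_add_mul_self (s := (y' - y) / y)
    (by rw [le_div_iff₀ hy]; linarith) (p := 7 / 5000) (by norm_num) (by norm_num)
  rw [show 1 + (y' - y) / y = y' / y by field_simp; ring, Real.div_rpow hy' hy.le,
    div_le_iff₀ (by positivity)] at h
  rwa [mul_comm]

lemma neg_rpow_half_le {p p' : ℝ} (hp : 0 < p) (h : p / 2 ≤ p') :
    p' ^ (-(1 / 5000) : ℝ) ≤ p ^ (-(1 / 5000) : ℝ) * 2 ^ (1 / 5000 : ℝ) := by
  refine (Real.rpow_le_rpow_of_nonpos (by positivity) h (by norm_num)).trans_eq ?_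
  rw [Real.div_rpow hp.le (by norm_num), Real.rpow_neg (by norm_num : (0 : ℝ) ≤ 2), div_inv_eq_mul]

lemma two_rpow_le {a : ℝ} (h0 : 0 ≤ a) (h1 : a ≤ 1) : (2 : ℝ) ^ a ≤ 1 + a := by
  have := rpow_one_add_le_one_add_mul_self (s := 1) (by norm_num) h0 h1
  norm_num at this
  linarith

lemma linear_factor_nonneg {d d' : ℝ} (hd : 0 ≤ d) (hd' : 0 ≤ d') :
    0 ≤ 1 + 7 / 5000 * ((d' - d) / (d + 1 / 5)) := by
  have : -1 ≤ (d' - d) / (d + 1 / 5) := by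
    rw [le_div_iff₀ (by linarith)]
    linarith
  linarith

lemma potential_le_crude {p p' d d' : ℝ} (hp : 0 < p) (hpp : p / 2 ≤ p') (hd : 0 ≤ d)
    (hd' : 0 ≤ d') (hdd : d' ≤ 2 * d) : potential p' d' ≤ potential p d * (1 + 8 / 5000) := by
  have h1 := neg_rpow_half_le hp hpp
  have h2 := rpow_two_mul_le (y := d + 1 / 5) (y' := d' + 1 / 5) (by linarith) (by linarith)
    (by linarith) (a := 7 / 5000) (by norm_num)
  have h3 : (2 : ℝ) ^ (1 / 5000 : ℝ) * 2 ^ (7 / 5000 : ℝ) ≤ 1 + 8 / 5000 := by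
    rw [← Real.rpow_add (by norm_num)]
    exact (two_rpow_le (by norm_num) (by norm_num)).trans_eq (by norm_num)
  have hp' : 0 < p' := by linarith
  calc potential p' d' ≤ (p ^ (-(1 / 5000) : ℝ) * 2 ^ (1 / 5000 : ℝ)) *
        ((d + 1 / 5) ^ (7 / 5000 : ℝ) * 2 ^ (7 / 5000 : ℝ)) :=
        mul_le_mul h1 h2 (by positivity) (by positivity)
    _ = potential p d * (2 ^ (1 / 5000 : ℝ) * 2 ^ (7 / 5000 : ℝ)) := by rw [potential]; ring
    _ ≤ _ := mul_le_mul_of_nonneg_left h3 (potential_nonneg hp hd)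

lemma potential_le_linear {p p' d d' : ℝ} (hp : 0 < p) (hpp : p / 2 ≤ p') (hd : 0 ≤ d)
    (hd' : 0 ≤ d') :
    potential p' d' ≤ potential p d *
      ((1 + 1 / 5000) * (1 + 7 / 5000 * ((d' - d) / (d + 1 / 5)))) := by
  have h1 := neg_rpow_half_le hp hpp
  have h2 := rpow_le_linear (y := d + 1 / 5) (y' := d' + 1 / 5) (by linarith) (by linarith)
  rw [add_sub_add_right_eq_sub] at h2
  have h3 := two_rpow_le (a := 1 / 5000) (by norm_num) (by norm_num)
  have h4 := linear_factor_nonneg hd hd'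
  have hp' : 0 < p' := by linarith
  calc potential p' d' ≤ (p ^ (-(1 / 5000) : ℝ) * 2 ^ (1 / 5000 : ℝ)) *
        ((d + 1 / 5) ^ (7 / 5000 : ℝ) * (1 + 7 / 5000 * ((d' - d) / (d + 1 / 5)))) :=
        mul_le_mul h1 h2 (by positivity) (by positivity)
    _ = potential p d * (2 ^ (1 / 5000 : ℝ) * (1 + 7 / 5000 * ((d' - d) / (d + 1 / 5)))) := by
        rw [potential]; ring
    _ ≤ _ := mul_le_mul_of_nonneg_left (mul_le_mul_of_nonneg_right h3 h4) (potential_nonneg hp hd)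

lemma potential_le_of_double {p d d' : ℝ} (hp : 0 < p) (hd : 0 ≤ d) (hd' : 0 ≤ d') :
    potential (2 * p) d' ≤ potential p d *
      ((1 - 1 / 10000) * (1 + 7 / 5000 * ((d' - d) / (d + 1 / 5)))) := by
  have h1 : (2 : ℝ) ^ (-(1 / 5000) : ℝ) ≤ 1 - 1 / 10000 := by
    have := rpow_one_add_le_one_add_mul_self (s := -(1 / 2)) (by norm_num) (p := 1 / 5000)
      (by norm_num) (by norm_num)
    rw [Real.rpow_neg (by norm_num), ← Real.inv_rpow (by norm_num)]
    norm_num at this ⊢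
    linarith
  have h2 := rpow_le_linear (y := d + 1 / 5) (y' := d' + 1 / 5) (by linarith) (by linarith)
  rw [add_sub_add_right_eq_sub] at h2
  have h4 := linear_factor_nonneg hd hd'
  rw [potential, Real.mul_rpow (by norm_num) hp.le]
  calc 2 ^ (-(1 / 5000) : ℝ) * p ^ (-(1 / 5000) : ℝ) * (d' + 1 / 5) ^ (7 / 5000 : ℝ)
      ≤ 2 ^ (-(1 / 5000) : ℝ) * p ^ (-(1 / 5000) : ℝ) *
        ((d + 1 / 5) ^ (7 / 5000 : ℝ) * (1 + 7 / 5000 * ((d' - d) / (d + 1 / 5)))) :=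
        mul_le_mul_of_nonneg_left h2 (by positivity)
    _ = potential p d * (2 ^ (-(1 / 5000) : ℝ) * (1 + 7 / 5000 * ((d' - d) / (d + 1 / 5)))) := by
        rw [potential]; ring
    _ ≤ _ := mul_le_mul_of_nonneg_left (mul_le_mul_of_nonneg_right h1 h4) (potential_nonneg hp hd)

variable {V : Type*} {I R : ℕ} {G : SimpleGraph V} {σ : V → NodeState} {v : V}

lemma Regular.pos' (hσ : Regular R σ) (hv : (σ v).terminated = false) :
    0 < (weights σ v : ℝ) := by
  exact_mod_cast hσ.pos v hv

lemma Regular.le_half' (hσ : Regular R σ) (v : V) : weights σ v ≤ 1 / 2 := by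
  have h : ((weights σ v : ℚ) : ℝ) ≤ ((1 / 2 : ℚ) : ℝ) := by
    push_cast
    exact (hσ.dyadic v).le_half
  exact_mod_cast h

/-- A second potential, which pays for the beeping probability of `v` in every round. -/
noncomputable def budget (σ : V → NodeState) (v : V) : ℝ :=
  4 * ind ((σ v).terminated = false) + 2 * weights σ v

lemma Regular.budget_nonneg (hσ : Regular R σ) (v : V) : 0 ≤ budget σ v := by
  have := hσ.nonneg v
  have := ind_nonneg ((σ v).terminated = false)
  unfold budget
  linarith

/-- The event that `v` may join simultaneously with a neighbor: `v` and some neighbor are marked,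
and all marked neighbors have chosen the same slots as `v`. -/
def Collision (G : SimpleGraph V) (c : V → RoundCoins I R) (q : V → ℚ) (v : V) : Prop :=
  Marks c q v ∧ (∃ w, G.Adj v w ∧ Marks c q w) ∧
    ∀ w, G.Adj v w → Marks c q w → (c w).2.2.2 = (c v).2.2.2

lemma collision_of_joins {c : V → RoundCoins I R} {q : V → ℚ} {u : V} (hadj : G.Adj v u)
    (hv : Joins G c q v) (hu : Joins G c q u) : Collision G c q v := by
  refine ⟨hv.1, ⟨u, hadj, hu.1⟩, fun w hw hm => Subtype.ext ?_⟩
  refine Finset.eq_of_subset_of_card_le (hv.2 w hw hm) ?_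
  rw [(c w).2.2.2.2, (c v).2.2.2.2]

lemma half_le_nextWeight_real (hσ : Regular R σ) (c : V → RoundCoins I R) :
    (weights σ v : ℝ) / 2 ≤ (nextWeight G c (weights σ) v : ℝ) := by
  exact_mod_cast half_le_nextWeight (G := G) (c := c) (hσ.nonneg' v) (hσ.le_half' v)

variable [Fintype V]

/-- The potential of node `v` in the states `σ`; it is `0` if `v` has terminated. -/
noncomputable def nodePotential (G : SimpleGraph V) (σ : V → NodeState) (v : V) : ℝ :=
  ind ((σ v).terminated = false) * potential (weights σ v) (effDegree G (weights σ) v)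

lemma nodePotential_of_terminated (h : (σ v).terminated = true) : nodePotential G σ v = 0 := by
  rw [nodePotential, ind_of_not (by simp [h]), zero_mul]

lemma nodePotential_of_active (h : (σ v).terminated = false) :
    nodePotential G σ v = potential (weights σ v) (effDegree G (weights σ) v) := by
  rw [nodePotential, ind_of h, one_mul]

/-- The potential after a round, for a node that survives. -/
lemma nodePotential_after (hI : 0 < I) (hσ : Regular R σ) {c : V → RoundCoins I R}
    (h : ¬ Ends G c σ v) :
    nodePotential G (slots G c σ (2 * I + 1)) v =
      potential (nextWeight G c (weights σ) v : ℝ) (effDegreeAfter G c σ v) := by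
  rw [Ends, Bool.not_eq_true] at h
  rw [nodePotential_of_active h, effDegreeAfter]
  congr 1
  rw [weights]
  exact weightAfter_of_active hI hσ.fresh h

lemma nodePotential_of_ends {c : V → RoundCoins I R} (h : Ends G c σ v) :
    nodePotential G (slots G c σ (2 * I + 1)) v = 0 := nodePotential_of_terminated h

lemma nodePotential_after_le_crude (hI : 0 < I) (hσ : Regular R σ)
    (hv : (σ v).terminated = false) (c : V → RoundCoins I R) :
    nodePotential G (slots G c σ (2 * I + 1)) v ≤
      nodePotential G σ v * (1 + 8 / 5000) * ind (¬ Ends G c σ v) := by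
  by_cases h : Ends G c σ v
  · rw [nodePotential_of_ends h, ind_of_not (not_not.2 h), mul_zero]
  · rw [nodePotential_after hI hσ h, ind_of h, mul_one, nodePotential_of_active hv]
    exact potential_le_crude (hσ.pos' hv) (half_le_nextWeight_real hσ c)
      (hσ.effDegree_nonneg v) (effDegreeAfter_nonneg hI hσ c v) (effDegreeAfter_le hI hσ c v)

lemma nodePotential_after_le_linear (hI : 0 < I) (hσ : Regular R σ)
    (hv : (σ v).terminated = false) (c : V → RoundCoins I R) :
    nodePotential G (slots G c σ (2 * I + 1)) v ≤ nodePotential G σ v *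
      ((1 + 1 / 5000) * (1 + 7 / 5000 * ((effDegreeAfter G c σ v - effDegree G (weights σ) v) /
        (effDegree G (weights σ) v + 1 / 5)))) := by
  rw [nodePotential_of_active hv]
  have hd := hσ.effDegree_nonneg (G := G) v
  have hd' := effDegreeAfter_nonneg (G := G) hI hσ c v
  by_cases h : Ends G c σ v
  · rw [nodePotential_of_ends h]
    exact mul_nonneg (potential_nonneg (hσ.pos' hv) hd)
      (mul_nonneg (by norm_num) (linear_factor_nonneg hd hd'))
  · rw [nodePotential_after hI hσ h]
    exact potential_le_linear (hσ.pos' hv) (half_le_nextWeight_real hσ c) hd hd'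

lemma nodePotential_after_le_of_quarter (hI : 0 < I) (hσ : Regular R σ)
    (hv : (σ v).terminated = false) (hq : weights σ v ≤ 1 / 4) (c : V → RoundCoins I R) :
    nodePotential G (slots G c σ (2 * I + 1)) v ≤ nodePotential G σ v *
      ((1 - 1 / 10000) * (1 + 7 / 5000 * ((effDegreeAfter G c σ v - effDegree G (weights σ) v) /
        (effDegree G (weights σ) v + 1 / 5))) +
        (1 + 8 / 5000) * ind (High G c (weights σ) v)) := by
  have hd := hσ.effDegree_nonneg (G := G) v
  have hd' := effDegreeAfter_nonneg (G := G) hI hσ c v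
  have hpot := potential_nonneg (hσ.pos' hv) hd
  have hlin := mul_nonneg (by norm_num : (0 : ℝ) ≤ 1 - 1 / 10000) (linear_factor_nonneg hd hd')
  by_cases hh : High G c (weights σ) v
  · refine (nodePotential_after_le_crude hI hσ hv c).trans ?_
    rw [nodePotential_of_active hv, ind_of hh, mul_assoc]
    refine mul_le_mul_of_nonneg_left ?_ hpot
    linarith [ind_le_one (¬ Ends G c σ v)]
  · rw [ind_of_not hh, mul_zero, add_zero, nodePotential_of_active hv]
    by_cases h : Ends G c σ v
    · rw [nodePotential_of_ends h]
      exact mul_nonneg hpot hlin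
    · rw [nodePotential_after hI hσ h, nextWeight, if_neg hh, min_eq_left (by linarith)]
      push_cast
      exact potential_le_of_double (hσ.pos' hv) hd hd'

variable [DecidableEq V] {F : (V → RoundCoins I R) → V → RoundCoins I R}

/-- In every round, the potential of a node shrinks in expectation. There are four cases: many
neighbors have low effective degree, and one of them joins with constant probability; otherwise,
if the effective degree of `v` is not small, then it shrinks in expectation; if it is small, then
either `v` has the maximum desire-level and joins with constant probability, or its desire-level
is doubled. -/
lemma expect_nodePotential_le (hI : LongInterval I) (hσ : Regular R σ)
    (hF : ∀ c, AgreeNear G v c (F c)) :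
    𝔼 c : V → RoundCoins I R, nodePotential G (slots G (F c) σ (2 * I + 1)) v ≤
      (1 - 7 / 250000) * nodePotential G σ v := by
  rcases hv : (σ v).terminated with _ | _
  swap
  · rw [nodePotential_of_terminated hv, mul_zero]
    refine (Finset.expect_eq_zero fun c _ => nodePotential_of_terminated ?_).le
    rw [slots_of_terminated hv, hv]
  have hpos := hσ.pos' hv
  have hd := hσ.effDegree_nonneg (G := G) v
  have hΦ : 0 ≤ nodePotential G σ v := by
    rw [nodePotential_of_active hv]
    exact potential_nonneg hpos hd
  -- in the cases with a constant probability of termination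
  have hcrude : 19 / 10000 ≤ prob (fun c => Ends G (F c) σ v) →
      𝔼 c : V → RoundCoins I R, nodePotential G (slots G (F c) σ (2 * I + 1)) v ≤
        (1 - 7 / 250000) * nodePotential G σ v := by
    intro hend
    calc _ ≤ 𝔼 c : V → RoundCoins I R, nodePotential G σ v * (1 + 8 / 5000) *
            ind (¬ Ends G (F c) σ v) :=
          expect_mono fun c => nodePotential_after_le_crude hI.1 hσ hv (F c)
      _ = nodePotential G σ v * (1 + 8 / 5000) * (1 - prob (fun c => Ends G (F c) σ v)) := by
          rw [← Finset.mul_expect, ← prob, prob_not]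
      _ ≤ (1 - 7 / 250000) * nodePotential G σ v := by nlinarith
  by_cases hlow : 1 / 100 ≤ lowDegree G (weights σ) v
  · exact hcrude (le_prob_ends_of_lowDegree hI hσ hF hlow)
  rw [not_le] at hlow
  have hdeg := expect_effDegreeAfter_le hI hσ hF
  have hdpos : 0 < effDegree G (weights σ) v + 1 / 5 := by linarith
  have hlin : 𝔼 c : V → RoundCoins I R,
      (1 + 7 / 5000 * ((effDegreeAfter G (F c) σ v - effDegree G (weights σ) v) /
        (effDegree G (weights σ) v + 1 / 5))) =
      1 + 7 / 5000 * ((𝔼 c : V → RoundCoins I R, effDegreeAfter G (F c) σ v -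
        effDegree G (weights σ) v) / (effDegree G (weights σ) v + 1 / 5)) := by
    rw [Finset.expect_add_distrib, ← Finset.mul_expect, ← Finset.expect_div,
      Finset.expect_sub_distrib, Fintype.expect_const, Fintype.expect_const]
  by_cases hmid : 15 / 100 ≤ effDegree G (weights σ) v
  · have hdec : (𝔼 c : V → RoundCoins I R, effDegreeAfter G (F c) σ v -
        effDegree G (weights σ) v) / (effDegree G (weights σ) v + 1 / 5) ≤ -(1 / 6) := by
      rw [div_le_iff₀ hdpos]
      linarith
    calc _ ≤ 𝔼 c : V → RoundCoins I R, nodePotential G σ v * ((1 + 1 / 5000) *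
            (1 + 7 / 5000 * ((effDegreeAfter G (F c) σ v - effDegree G (weights σ) v) /
              (effDegree G (weights σ) v + 1 / 5)))) :=
          expect_mono fun c => nodePotential_after_le_linear hI.1 hσ hv (F c)
      _ ≤ (1 - 7 / 250000) * nodePotential G σ v := by
          rw [← Finset.mul_expect, ← Finset.mul_expect, hlin]
          nlinarith
  rw [not_le] at hmid
  rcases hσ.dyadic v with h0 | ⟨k, hk1, hkR, hk⟩
  · rw [h0] at hpos
    simp at hpos
  obtain rfl | hk2 := hk1.eq_or_lt
  · refine hcrude (le_trans ?_ (le_prob_ends hI hσ hF))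
    rw [hk]
    push_cast
    linarith
  · have hquarter : weights σ v ≤ 1 / 4 := by
      rw [hk]
      exact (pow_le_pow_of_le_one (by norm_num) (by norm_num) hk2).trans (by norm_num)
    have hinc : (𝔼 c : V → RoundCoins I R, effDegreeAfter G (F c) σ v -
        effDegree G (weights σ) v) / (effDegree G (weights σ) v + 1 / 5) ≤ 5 / 100 := by
      have hle : lowDegree G (weights σ) v ≤ effDegree G (weights σ) v := by
        refine Finset.sum_le_sum_of_subset_of_nonneg ?_ fun u _ _ => hσ.nonneg u
        intro u hu
        simp only [Finset.mem_filter, Finset.mem_univ, true_and] at hu ⊢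
        exact hu.1
      rw [div_le_iff₀ hdpos]
      linarith
    have hhigh := (prob_high_le (I := I) hσ.dyadic hmid.le).trans hI.2
    calc _ ≤ 𝔼 c : V → RoundCoins I R, nodePotential G σ v * ((1 - 1 / 10000) *
            (1 + 7 / 5000 * ((effDegreeAfter G (F c) σ v - effDegree G (weights σ) v) /
              (effDegree G (weights σ) v + 1 / 5))) +
            (1 + 8 / 5000) * ind (High G c (weights σ) v)) := by
          refine expect_mono fun c => ?_
          rw [← (hF c).high_self]
          exact nodePotential_after_le_of_quarter hI.1 hσ hv hquarter (F c)
      _ = nodePotential G σ v * ((1 - 1 / 10000) *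
            (1 + 7 / 5000 * ((𝔼 c : V → RoundCoins I R, effDegreeAfter G (F c) σ v -
              effDegree G (weights σ) v) / (effDegree G (weights σ) v + 1 / 5))) +
            (1 + 8 / 5000) * prob (fun c : V → RoundCoins I R => High G c (weights σ) v)) := by
          rw [← Finset.mul_expect, Finset.expect_add_distrib, ← Finset.mul_expect, hlin,
            ← Finset.mul_expect, prob]
      _ ≤ (1 - 7 / 250000) * nodePotential G σ v := by nlinarith

/-- If the effective degree of `v` is low, then `v` joins with probability proportional to its
beeping probability; otherwise, its beeping probability is expected to shrink. -/
lemma expect_budget_le (hI : LongInterval I) (hσ : Regular R σ)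
    (hF : ∀ c, AgreeNear G v c (F c)) :
    𝔼 c : V → RoundCoins I R, budget (slots G (F c) σ (2 * I + 1)) v ≤
      budget σ v - 4 / 5 * weights σ v := by
  rcases hv : (σ v).terminated with _ | _
  swap
  · have hw : weights σ v = 0 := weight_of_terminated hv
    have h0 : budget σ v = 0 := by
      rw [budget, hw, ind_of_not (by simp [hv])]
      simp
    rw [h0, hw, Rat.cast_zero, mul_zero, sub_zero]
    refine (Finset.expect_eq_zero fun c _ => ?_).le
    rw [budget, weights, slots_of_terminated hv, ind_of_not (by simp [hv])]
    rw [weights] at hw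
    simp [hw]
  have heq : 𝔼 c : V → RoundCoins I R, budget (slots G (F c) σ (2 * I + 1)) v =
      4 * (1 - prob (fun c => Ends G (F c) σ v)) +
        2 * 𝔼 c : V → RoundCoins I R, weightAfter G (F c) σ v := by
    rw [← prob_not, prob, Finset.mul_expect, Finset.mul_expect, ← Finset.expect_add_distrib]
    refine Finset.expect_congr rfl fun c _ => ?_
    rw [budget, Ends, Bool.not_eq_true]
    rfl
  rw [heq, budget, ind_of hv]
  have hpos := hσ.pos' hv
  by_cases hd : 3 / 10 ≤ effDegree G (weights σ) v
  · have h1 := expect_weightAfter_le (u := v) hI hσ (fun c => (hF c).high_self) hd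
    have h2 := prob_nonneg (fun c => Ends G (F c) σ v)
    linarith
  · have h1 := le_prob_ends hI hσ hF
    have h2 : 𝔼 c : V → RoundCoins I R, weightAfter G (F c) σ v ≤ 2 * weights σ v :=
      (expect_mono fun c => weightAfter_le hI.1 hσ _ v).trans_eq (Fintype.expect_const _)
    rw [not_le] at hd
    nlinarith

lemma prob_collision_le (hσ : Regular R σ) (hF : ∀ c, AgreeNear G v c (F c)) :
    prob (fun c => Collision G (F c) (weights σ) v) ≤
      weights σ v * (1 / (I.choose (I / 2) : ℝ)) := by
  classical
  refine le_trans (prob_mono fun c hc => ?_) (prob_marks_same_slots_le (I := I) hσ.dyadic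
    (u := v) (T := Finset.univ.filter (G.Adj v)) (by simp))
  obtain ⟨h1, ⟨w, hw, hm⟩, h2⟩ := hc
  have hmarks : ∀ w, G.Adj v w → (Marks (F c) (weights σ) w ↔ Marks c (weights σ) w) :=
    fun w hw => by rw [Marks, Marks, (hF c).neighbor hw]
  refine ⟨by rwa [Marks, ← (hF c).self], ⟨w, by simp [hw], (hmarks w hw).1 hm⟩, fun x hx hmx => ?_⟩
  have hadj : G.Adj v x := by simpa using hx
  have := h2 x hadj ((hmarks x hadj).2 hmx)
  rwa [(hF c).neighbor hadj, (hF c).self] at this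

end Potential

/-! ### All rounds -/

section Rounds

open scoped BigOperators

variable {V : Type*} {I R : ℕ} {G : SimpleGraph V} {v : V}

lemma Dyadic.mono {m n : ℕ} (h : m ≤ n) {p : ℚ} (hp : Dyadic m p) : Dyadic n p := by
  obtain rfl | ⟨k, h1, h2, rfl⟩ := hp
  exacts [.inl rfl, .inr ⟨k, h1, h2.trans h, rfl⟩]

lemma Regular.mono {m n : ℕ} (h : m ≤ n) {σ : V → NodeState} (hσ : Regular m σ) : Regular n σ :=
  ⟨hσ.fresh, fun u => (hσ.dyadic u).mono h, hσ.pos⟩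

lemma dyadic_nextWeight {m : ℕ} {q : V → ℚ} {u : V} (c : V → RoundCoins I R)
    (hq : Dyadic m (q u)) (hpos : 0 < q u) :
    Dyadic (m + 1) (nextWeight G c q u) ∧ 0 < nextWeight G c q u := by
  obtain h0 | ⟨k, h1, h2, hk⟩ := hq
  · exact absurd h0 hpos.ne'
  have key : ∃ j, 1 ≤ j ∧ j ≤ m + 1 ∧ nextWeight G c q u = (1 / 2) ^ j := by
    rw [nextWeight, hk]
    split_ifs
    · exact ⟨k + 1, by omega, by omega, by rw [pow_succ]; ring⟩
    · obtain ⟨j, rfl⟩ := Nat.exists_eq_add_of_le' h1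
      rcases j with _ | j
      · exact ⟨1, le_rfl, by omega, by norm_num⟩
      · refine ⟨j + 1, by omega, by omega, ?_⟩
        rw [min_eq_left]
        · rw [pow_succ _ (j + 1)]; ring
        · have : (1 / 2 : ℚ) ^ (j + 1 + 1) ≤ (1 / 2) ^ 2 :=
            pow_le_pow_of_le_one (by norm_num) (by norm_num) (by omega)
          norm_num at this ⊢
          linarith
  obtain ⟨j, hj1, hj2, hj⟩ := key
  exact ⟨.inr ⟨j, hj1, hj2, hj⟩, by rw [hj]; positivity⟩

lemma Regular.slots (hI : 0 < I) {m : ℕ} {σ : V → NodeState} (hσ : Regular m σ)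
    (c : V → RoundCoins I R) : Regular (m + 1) (slots G c σ (2 * I + 1)) := by
  have key : ∀ u, (BeepMIS.slots G c σ (2 * I + 1) u).terminated = false →
      Dyadic (m + 1) (weights (BeepMIS.slots G c σ (2 * I + 1)) u) ∧
        0 < weights (BeepMIS.slots G c σ (2 * I + 1)) u := by
    intro u hu
    have hu0 : (σ u).terminated = false := by
      by_contra h
      rw [Bool.not_eq_false] at h
      rw [slots_of_terminated h, h] at hu
      cases hu
    rw [weights, weight_of_active hu, slots_last hI hσ.fresh hu]
    exact dyadic_nextWeight c (hσ.dyadic u) (hσ.pos u hu0)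
  refine ⟨Fresh.slots hI hσ.fresh, fun u => ?_, fun u hu => (key u hu).2⟩
  rcases hu : (BeepMIS.slots G c σ (2 * I + 1) u).terminated with _ | _
  · exact (key u hu).1
  · exact .inl (weight_of_terminated hu)

/-- The states of all nodes at the beginning of round `t`. -/
noncomputable def roundState (G : SimpleGraph V) (ω : Coins V I R) (t : ℕ) : V → NodeState :=
  run G ω (t * (2 * I + 1))

lemma roundState_zero (ω : Coins V I R) (u : V) : roundState G ω 0 u = NodeState.init := by
  rw [roundState, zero_mul, run]

lemma roundState_succ (ω : Coins V I R) (t : Fin R) :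
    roundState G ω (t + 1) = slots G (fun u => ω u t) (roundState G ω t) (2 * I + 1) := by
  rw [roundState, add_mul, one_mul, run_add_eq_slots t le_rfl, roundState]

lemma regular_roundState (hI : 0 < I) (ω : Coins V I R) {t : ℕ} (ht : t ≤ R) :
    Regular (t + 1) (roundState G ω t) := by
  induction t with
  | zero =>
    have h : ∀ u, weights (roundState G ω 0) u = 1 / 2 := by
      intro u
      rw [weights, roundState_zero]
      rfl
    refine ⟨fun u _ => ?_, fun u => .inr ⟨1, le_rfl, le_rfl, by rw [h]; norm_num⟩,
      fun u _ => by rw [h]; norm_num⟩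
    rw [roundState_zero]
    rfl
  | succ t ih =>
    have := roundState_succ (G := G) ω ⟨t, ht⟩
    dsimp only at this
    rw [this]
    exact (ih (by omega)).slots hI _

/-- Two neighbors that output `IN` simultaneously collide in some round. -/
lemma Simultaneous.exists_collision (hI : 0 < I) {ω : Coins V I R} {u : V} {n : ℕ}
    (hadj : G.Adj v u) (h : Simultaneous G ω v u n) :
    ∃ t : Fin R, Collision G (fun w => ω w t) (weights (roundState G ω t)) v := by
  obtain ⟨hv0, hv1, hu0, hu1⟩ := h
  obtain ⟨hmod, hlt⟩ := (consistent_run (G := G) (ω := ω) (n + 1) v).active_in hv1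
    (active_of_new_in (by simp [hv0]) hv1)
  set t : Fin R := ⟨(n + 1) / (2 * I + 1), hlt⟩ with ht
  have hn : n + 1 = t * (2 * I + 1) + 2 * I := by
    have := Nat.div_add_mod (n + 1) (2 * I + 1)
    rw [hmod, mul_comm] at this
    exact this.symm
  have hfresh := (regular_roundState (G := G) hI ω t.2.le).fresh
  have key : ∀ w, (run G ω n w).output = none → (run G ω (n + 1) w).output = some .IN →
      Joins G (fun w => ω w t) (weights (roundState G ω t)) w := by
    intro w hw0 hw1
    rw [hn, run_add_eq_slots t (by omega)] at hw1
    refine (output_slots_second_iff hI hfresh ?_).1 hw1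
    by_contra hterm
    rw [Bool.not_eq_false] at hterm
    rw [slots_of_terminated (by exact hterm)] at hw1
    have := output_run_mono (n' := n) (by omega) hw1
    rw [hw0] at this
    cases this
  exact ⟨t, collision_of_joins hadj (key v hv0 hv1) (key u hu0 hu1)⟩

/-- Replace the coins of round `t` by `c`. -/
def setRound (ω : Coins V I R) (t : Fin R) (c : V → RoundCoins I R) : Coins V I R :=
  fun u => Function.update (ω u) t (c u)

variable {adv : Coins V I R → Coins V I R}

/-- The coins of round `t` that the adversary plays when the random coins of this round are `c`. -/
def advRound (adv : Coins V I R → Coins V I R) (ω : Coins V I R) (t : Fin R)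
    (c : V → RoundCoins I R) : V → RoundCoins I R :=
  fun u => adv (setRound ω t c) u t

lemma IsAdversary.agreeNear (hadv : IsAdversary G v adv) (ω : Coins V I R) (t : Fin R)
    (c : V → RoundCoins I R) : AgreeNear G v c (advRound adv ω t c) := by
  intro u hu
  rw [advRound, hadv.inside _ _ hu, setRound, Function.update_self]

/-- The coins of round `t` do not influence the states before this round. -/
lemma IsAdversary.roundState_setRound (hadv : IsAdversary G v adv) (ω : Coins V I R) (t : Fin R)
    (c : V → RoundCoins I R) :
    roundState G (adv (setRound ω t c)) t = roundState G (adv ω) t := by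
  refine run_congr fun u s hs => hadv.nonanticipating _ _ s (fun w r hr => ?_) u
  have hst : s < t := Fin.lt_def.2 (lt_of_mul_lt_mul_right hs (Nat.zero_le _))
  rw [setRound, Function.update_of_ne (hr.trans_lt hst).ne]

variable [Fintype V] [DecidableEq V]

lemma expect_setRound (f : Coins V I R → ℝ) (t : Fin R) :
    𝔼 ω, f ω = 𝔼 ω, 𝔼 c, f (setRound ω t c) := by
  let e : Coins V I R ≃ (Fin R → V → RoundCoins I R) :=
    Equiv.piComm fun (_ : V) (_ : Fin R) => RoundCoins I R
  let g : (Fin R → V → RoundCoins I R) → ℝ := fun x => f (e.symm x)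
  have h : 𝔼 ω, f ω = 𝔼 x, g x := Fintype.expect_equiv e f g fun ω => rfl
  rw [h, expect_resample g t]
  refine (Fintype.expect_equiv e (fun ω => 𝔼 c, f (setRound ω t c))
    (fun x => 𝔼 c, g (Function.update x t c)) fun ω => Finset.expect_congr rfl fun c _ => ?_).symm
  refine congrArg f (funext fun u => funext fun s => ?_)
  by_cases hs : s = t
  · subst hs
    simp [e, setRound, Equiv.piComm, Function.swap]
  · simp [e, setRound, Equiv.piComm, Function.swap, hs]

/-- One more round is averaged over its own coins first. -/
lemma IsAdversary.expect_roundState_succ (hadv : IsAdversary G v adv) (t : Fin R)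
    (g : (V → NodeState) → ℝ) :
    𝔼 ω, g (roundState G (adv ω) (t + 1)) =
      𝔼 ω, 𝔼 c, g (slots G (advRound adv ω t c) (roundState G (adv ω) t) (2 * I + 1)) := by
  rw [expect_setRound _ t]
  refine Finset.expect_congr rfl fun ω _ => Finset.expect_congr rfl fun c _ => ?_
  rw [roundState_succ, hadv.roundState_setRound]
  rfl

/-- The potential of `v` decays exponentially. -/
lemma IsAdversary.expect_nodePotential_le (hadv : IsAdversary G v adv) (hI : LongInterval I)
    {t : ℕ} (ht : t ≤ R) :
    𝔼 ω : Coins V I R, nodePotential G (roundState G (adv ω) t) v ≤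
      (1 - 7 / 250000) ^ t * potential (1 / 2) (effDegree G (fun _ => 1 / 2) v) := by
  induction t with
  | zero =>
    rw [pow_zero, one_mul]
    refine (Finset.expect_congr rfl fun ω _ => ?_).trans (Fintype.expect_const _) |>.le
    have h : weights (roundState G (adv ω) 0) = fun _ => 1 / 2 := by
      funext u
      rw [weights, roundState_zero]
      rfl
    rw [nodePotential_of_active (by rw [roundState_zero]; rfl), h]
    norm_num
  | succ t ih =>
    have h := hadv.expect_roundState_succ ⟨t, ht⟩ fun σ => nodePotential G σ v
    dsimp only at h
    rw [h, pow_succ', mul_assoc]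
    calc _ ≤ 𝔼 ω : Coins V I R, (1 - 7 / 250000) * nodePotential G (roundState G (adv ω) t) v :=
          expect_mono fun ω => BeepMIS.expect_nodePotential_le hI
            ((regular_roundState hI.1 _ (by omega)).mono ht) (hadv.agreeNear ω ⟨t, ht⟩)
      _ ≤ _ := by
          rw [← Finset.mul_expect]
          exact mul_le_mul_of_nonneg_left (ih (by omega)) (by norm_num)

lemma prob_active_le (hadv : IsAdversary G v adv) (hI : LongInterval I) :
    prob (fun ω : Coins V I R => (roundState G (adv ω) R v).terminated = false) ≤
      (1 - 7 / 250000) ^ R *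
        (5 * effDegree G (fun _ => 1 / 2) v + 1) ^ (7 / 5000 : ℝ) := by
  set D := effDegree G (fun _ => 1 / 2) v with hD
  have hD0 : 0 ≤ D := Finset.sum_nonneg fun u _ => by norm_num
  set m : ℝ := (1 / 2) ^ (-(1 / 5000) : ℝ) * (1 / 5) ^ (7 / 5000 : ℝ) with hm
  have hmpos : 0 < m := by positivity
  have h1 : ∀ ω : Coins V I R, m * ind ((roundState G (adv ω) R v).terminated = false) ≤
      nodePotential G (roundState G (adv ω) R) v := by
    intro ω
    have hreg := regular_roundState (G := G) hI.1 (adv ω) (le_refl R)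
    by_cases h : (roundState G (adv ω) R v).terminated = false
    · rw [ind_of h, mul_one, nodePotential_of_active h, potential]
      have hd := hreg.effDegree_nonneg (G := G) v
      refine mul_le_mul ?_ ?_ (by positivity) ?_
      · exact Real.rpow_le_rpow_of_nonpos (hreg.pos' h) (hreg.dyadic v).le_half (by norm_num)
      · exact Real.rpow_le_rpow (by norm_num) (by linarith) (by norm_num)
      · exact Real.rpow_nonneg (hreg.nonneg v) _
    · rw [ind_of_not h, mul_zero, nodePotential_of_terminated (by simpa using h)]
  have h2 : m * prob (fun ω : Coins V I R => (roundState G (adv ω) R v).terminated = false) ≤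
      (1 - 7 / 250000) ^ R * potential (1 / 2) D := by
    rw [prob, Finset.mul_expect]
    exact (expect_mono h1).trans (hadv.expect_nodePotential_le hI le_rfl)
  have h3 : potential (1 / 2) D = m * (5 * D + 1) ^ (7 / 5000 : ℝ) := by
    rw [potential, hm, mul_assoc, ← Real.mul_rpow (by norm_num) (by linarith)]
    congr 2
    ring
  rw [h3, mul_left_comm] at h2
  exact le_of_mul_le_mul_left h2 hmpos

/-- The expected sum of the beeping probabilities of `v` over all rounds is bounded. -/
lemma IsAdversary.sum_expect_weight_le (hadv : IsAdversary G v adv) (hI : LongInterval I)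
    {t : ℕ} (ht : t ≤ R) :
    𝔼 ω : Coins V I R, budget (roundState G (adv ω) t) v +
      4 / 5 * ∑ s ∈ Finset.range t,
        𝔼 ω : Coins V I R, (weights (roundState G (adv ω) s) v : ℝ) ≤ 5 := by
  induction t with
  | zero =>
    rw [Finset.range_zero, Finset.sum_empty, mul_zero, add_zero]
    refine (Finset.expect_congr rfl fun ω _ => ?_).trans (Fintype.expect_const _) |>.le
    rw [budget, weights, roundState_zero, ind_of (show NodeState.init.terminated = false from rfl),
      weight_of_active rfl, NodeState.init]
    norm_num
  | succ t ih =>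
    have h := hadv.expect_roundState_succ ⟨t, ht⟩ fun σ => budget σ v
    dsimp only at h
    have h2 : 𝔼 ω : Coins V I R, budget (roundState G (adv ω) (t + 1)) v ≤
        𝔼 ω : Coins V I R, budget (roundState G (adv ω) t) v -
          4 / 5 * 𝔼 ω : Coins V I R, (weights (roundState G (adv ω) t) v : ℝ) := by
      rw [h, Finset.mul_expect, ← Finset.expect_sub_distrib]
      exact expect_mono fun ω => expect_budget_le hI
        ((regular_roundState hI.1 _ (by omega)).mono ht) (hadv.agreeNear ω ⟨t, ht⟩)
    rw [Finset.sum_range_succ]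
    linarith [ih (by omega)]

lemma prob_exists_le {ι α : Type*} [Fintype ι] [Fintype α] (P : ι → α → Prop) :
    prob (fun a => ∃ i, P i a) ≤ ∑ i, prob (P i) := by
  simp only [prob]
  rw [← Finset.expect_sum_comm]
  refine expect_mono fun a => ?_
  by_cases h : ∃ i, P i a
  · obtain ⟨i, hi⟩ := h
    rw [ind_of ⟨i, hi⟩, ← ind_of hi]
    exact Finset.single_le_sum (f := fun i => ind (P i a)) (fun i _ => ind_nonneg _)
      (Finset.mem_univ i)
  · rw [ind_of_not h]
    exact Finset.sum_nonneg fun i _ => ind_nonneg _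

lemma prob_exists_collision_le (hadv : IsAdversary G v adv) (hI : LongInterval I) :
    prob (fun ω : Coins V I R => ∃ t : Fin R,
        Collision G (fun w => adv ω w t) (weights (roundState G (adv ω) t)) v) ≤
      25 / 4 * (1 / (I.choose (I / 2) : ℝ)) := by
  refine (prob_exists_le _).trans ?_
  have h1 : ∀ t : Fin R, prob (fun ω : Coins V I R =>
      Collision G (fun w => adv ω w t) (weights (roundState G (adv ω) t)) v) ≤
      (𝔼 ω : Coins V I R, (weights (roundState G (adv ω) t) v : ℝ)) *
        (1 / (I.choose (I / 2) : ℝ)) := by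
    intro t
    rw [prob, expect_setRound _ t, Finset.expect_mul]
    refine expect_mono fun ω => ?_
    simp only [hadv.roundState_setRound]
    exact prob_collision_le ((regular_roundState hI.1 _ t.2.le).mono t.2) (hadv.agreeNear ω t)
  refine (Finset.sum_le_sum fun t _ => h1 t).trans ?_
  rw [← Finset.sum_mul]
  refine mul_le_mul_of_nonneg_right ?_ (by positivity)
  have h2 := hadv.sum_expect_weight_le hI (le_refl R)
  have h3 : 0 ≤ 𝔼 ω : Coins V I R, budget (roundState G (adv ω) R) v :=
    Finset.expect_nonneg fun ω _ => (regular_roundState hI.1 _ le_rfl).budget_nonneg v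
  rw [Finset.sum_range] at h2
  linarith

end Rounds

/-! ### The parameters -/

section Parameters

lemma one_le_logb_two_div {ε : ℝ} (h0 : 0 < ε) (h1 : ε < 1) : 1 ≤ Real.logb 2 (2 / ε) := by
  rw [Real.le_logb_iff_rpow_le (by norm_num) (by positivity), Real.rpow_one, le_div_iff₀ h0]
  linarith

lemma lg_nonneg (Δ : ℕ) : 0 ≤ lg Δ := Real.logb_nonneg (by norm_num) (le_max_right _ _)

lemma log_le_logb {x : ℝ} (hx : 1 ≤ x) : Real.log x ≤ Real.logb 2 x := by
  rw [Real.logb, le_div_iff₀ (Real.log_pos (by norm_num))]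
  nlinarith [Real.log_nonneg hx, Real.log_two_lt_d9]

lemma log_two_le_log {ε : ℝ} (h0 : 0 < ε) (h1 : ε < 1) : Real.log 2 ≤ Real.log (2 / ε) :=
  Real.log_le_log (by norm_num) (by rw [le_div_iff₀ h0]; linarith)

lemma log_1500_ge : 10 * Real.log 2 ≤ Real.log 1500 := by
  have h : (10 : ℝ) * Real.log 2 = Real.log (2 ^ 10) := by
    rw [Real.log_pow]
    norm_num
  rw [h]
  exact Real.log_le_log (by norm_num) (by norm_num)

lemma log_1500_le : Real.log 1500 ≤ 11 := by
  have h : (11 : ℝ) * Real.log 2 = Real.log (2 ^ 11) := by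
    rw [Real.log_pow]
    norm_num
  have h2 : Real.log 1500 ≤ Real.log (2 ^ 11) := Real.log_le_log (by norm_num) (by norm_num)
  linarith [Real.log_two_lt_d9]

lemma le_intervalLength (ε : ℝ) :
    2000 * (Real.log 1500 + Real.log (2 / ε)) ≤ intervalLength ε := Nat.le_ceil _

lemma longInterval {ε : ℝ} (h0 : 0 < ε) (h1 : ε < 1) : LongInterval (intervalLength ε) := by
  have hI : (6400 : ℝ) ≤ intervalLength ε := by
    have := le_intervalLength ε
    linarith [log_1500_ge, log_two_le_log h0 h1, Real.log_two_gt_d9]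
  have hI' : 6400 ≤ intervalLength ε := by exact_mod_cast hI
  refine ⟨by omega, ?_⟩
  have h2 : ((997 : ℝ) / 1000) ^ intervalLength ε ≤ ((997 / 1000) ^ 256) ^ 25 := by
    rw [← pow_mul]
    exact pow_le_pow_of_le_one (by norm_num) (by norm_num) hI'
  have h3 : ((997 : ℝ) / 1000) ^ 256 ≤ 1 / 2 := by norm_num
  have h4 : (((997 : ℝ) / 1000) ^ 256) ^ 25 ≤ (1 / 2) ^ 25 :=
    pow_le_pow_left₀ (by positivity) h3 25
  norm_num at h4 h2 ⊢
  linarith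

lemma two_pow_le_centralBinom (n : ℕ) : 2 ^ n ≤ n.centralBinom := by
  induction n with
  | zero => simp
  | succ n ih =>
    have h : (n + 1) * 2 ^ (n + 1) ≤ (n + 1) * (n + 1).centralBinom := by
      rw [Nat.succ_mul_centralBinom_succ, pow_succ]
      nlinarith
    exact Nat.le_of_mul_le_mul_left h n.succ_pos

lemma two_pow_half_le_choose (n : ℕ) : 2 ^ (n / 2) ≤ n.choose (n / 2) :=
  (two_pow_le_centralBinom _).trans (Nat.choose_le_choose _ (Nat.mul_div_le n 2))

/-- The probability that two nodes choose the same slots is much smaller than `ε`. -/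
lemma one_div_choose_le {ε : ℝ} (h0 : 0 < ε) (h1 : ε < 1) :
    25 / 4 * (1 / ((intervalLength ε).choose (intervalLength ε / 2) : ℝ)) ≤ ε / 2 := by
  set n := intervalLength ε with hn
  have hx : (0 : ℝ) < 2 / ε := by positivity
  have hm : ((n : ℝ) - 1) / 2 ≤ ((n / 2 : ℕ) : ℝ) := by
    have : n ≤ 2 * (n / 2) + 1 := by omega
    have : (n : ℝ) ≤ 2 * ((n / 2 : ℕ) : ℝ) + 1 := by exact_mod_cast this
    linarith
  have hlog : 2 + Real.log (2 / ε) ≤ Real.log 2 * ((n / 2 : ℕ) : ℝ) := by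
    have := le_intervalLength ε
    rw [← hn] at this
    nlinarith [log_1500_ge, log_two_le_log h0 h1, Real.log_two_gt_d9]
  have h2 : 25 / 4 * (2 / ε) ≤ (2 : ℝ) ^ (n / 2) := by
    rw [← Real.rpow_natCast, Real.rpow_def_of_pos (by norm_num)]
    refine le_trans ?_ (Real.exp_le_exp.2 hlog)
    rw [Real.exp_add, Real.exp_log hx]
    refine mul_le_mul_of_nonneg_right ?_ hx.le
    have h3 : Real.exp 2 = Real.exp 1 * Real.exp 1 := by rw [← Real.exp_add]; norm_num
    rw [h3]
    nlinarith [Real.exp_one_gt_d9]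
  have h3 : (2 : ℝ) ^ (n / 2) ≤ (n.choose (n / 2) : ℝ) := by
    exact_mod_cast two_pow_half_le_choose n
  have hpos : (0 : ℝ) < (n.choose (n / 2) : ℝ) := lt_of_lt_of_le (by positivity) h3
  rw [mul_one_div, div_le_iff₀ hpos]
  have h4 : 25 / 4 * (2 / ε) ≤ (n.choose (n / 2) : ℝ) := h2.trans h3
  have h5 : ε * (25 / 4 * (2 / ε)) = 25 / 2 := by field_simp; norm_num
  nlinarith

/-- The number of rounds beats the initial potential. -/
lemma decay_le {ε : ℝ} (h0 : 0 < ε) (h1 : ε < 1) (Δ : ℕ) {D : ℝ} (hD0 : 0 ≤ D)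
    (hD : D ≤ Δ / 2) :
    (1 - 7 / 250000) ^ numRounds Δ ε * (5 * D + 1) ^ (7 / 5000 : ℝ) ≤ ε / 2 := by
  set M : ℝ := max (Δ : ℝ) 1 with hM
  have hM1 : 1 ≤ M := le_max_right _ _
  have hMD : (Δ : ℝ) ≤ M := le_max_left _ _
  have hM0 : 0 ≤ Real.log M := Real.log_nonneg hM1
  have hE : Real.log 2 ≤ Real.log (2 / ε) := log_two_le_log h0 h1
  have hR : 104000 * (Real.log M + Real.log (2 / ε)) ≤ numRounds Δ ε := by
    refine le_trans ?_ (Nat.le_ceil _)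
    have h2 : Real.log (2 / ε) ≤ Real.logb 2 (2 / ε) :=
      log_le_logb (by rw [le_div_iff₀ h0]; linarith)
    have h3 : Real.log M ≤ lg Δ := log_le_logb hM1
    linarith
  have h2 : ((1 : ℝ) - 7 / 250000) ^ numRounds Δ ε ≤ Real.exp (-(7 / 250000) * numRounds Δ ε) := by
    rw [mul_comm, Real.exp_nat_mul]
    refine pow_le_pow_left₀ (by norm_num) ?_ _
    linarith [Real.add_one_le_exp (-(7 / 250000) : ℝ)]
  have h3 : (5 * D + 1) ^ (7 / 5000 : ℝ) ≤
      Real.exp ((2 * Real.log 2 + Real.log M) * (7 / 5000)) := by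
    have h4 : Real.exp (2 * Real.log 2 + Real.log M) = 4 * M := by
      rw [two_mul, Real.exp_add, Real.exp_add, Real.exp_log (by norm_num),
        Real.exp_log (by linarith)]
      norm_num
    rw [Real.exp_mul, h4]
    exact Real.rpow_le_rpow (by linarith) (by linarith) (by norm_num)
  calc (1 - 7 / 250000) ^ numRounds Δ ε * (5 * D + 1) ^ (7 / 5000 : ℝ)
      ≤ Real.exp (-(7 / 250000) * numRounds Δ ε) *
          Real.exp ((2 * Real.log 2 + Real.log M) * (7 / 5000)) :=
        mul_le_mul h2 h3 (by positivity) (Real.exp_pos _).le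
    _ ≤ Real.exp (-Real.log (2 / ε)) := by
        rw [← Real.exp_add, Real.exp_le_exp]
        have := Real.log_two_gt_d9
        nlinarith
    _ = ε / 2 := by rw [Real.exp_neg, Real.exp_log (by positivity), inv_div]

/-- The number of slots of the whole execution. -/
lemma numRounds_mul_le {ε : ℝ} (h0 : 0 < ε) (h1 : ε < 1) (Δ : ℕ) :
    ((numRounds Δ ε * (2 * intervalLength ε + 1) : ℕ) : ℝ) ≤
      10000000000 * ((lg Δ + Real.logb 2 (2 / ε)) * Real.logb 2 (2 / ε)) := by
  have hL := one_le_logb_two_div h0 h1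
  have hlg := lg_nonneg Δ
  set L := Real.logb 2 (2 / ε) with hLdef
  have hlogL : Real.log (2 / ε) ≤ L := log_le_logb (by rw [le_div_iff₀ h0]; linarith)
  have hlog0 : 0 ≤ Real.log (2 / ε) := (Real.log_nonneg (by norm_num)).trans (log_two_le_log h0 h1)
  have hR : (numRounds Δ ε : ℝ) ≤ 104001 * (lg Δ + L) := by
    have : (numRounds Δ ε : ℝ) < 104000 * (lg Δ + L) + 1 := Nat.ceil_lt_add_one (by positivity)
    linarith
  have hI : (intervalLength ε : ℝ) ≤ 24001 * L := by
    have h2 : (intervalLength ε : ℝ) < 2000 * (Real.log 1500 + Real.log (2 / ε)) + 1 :=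
      Nat.ceil_lt_add_one (mul_nonneg (by norm_num)
        (add_nonneg (Real.log_nonneg (by norm_num)) hlog0))
    linarith [log_1500_le]
  push_cast
  calc (numRounds Δ ε : ℝ) * (2 * intervalLength ε + 1)
      ≤ (104001 * (lg Δ + L)) * (48003 * L) :=
        mul_le_mul hR (by linarith) (by positivity) (by positivity)
    _ = (104001 * 48003) * ((lg Δ + L) * L) := by ring
    _ ≤ 10000000000 * ((lg Δ + L) * L) :=
        mul_le_mul_of_nonneg_right (by norm_num) (by positivity)

end Parameters

/-! ### The probability of success -/

section Conclusion

open scoped BigOperators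

lemma toOuterMeasure_eq_prob {α : Type*} [Fintype α] [Nonempty α] (S : Set α) :
    (PMF.uniformOfFintype α).toOuterMeasure S = ENNReal.ofReal (prob (· ∈ S)) := by
  classical
  rw [PMF.toOuterMeasure_uniformOfFintype_apply, prob, Fintype.expect_eq_sum_div_card]
  simp only [ind]
  rw [Finset.sum_boole, ENNReal.ofReal_div_of_pos (by exact_mod_cast Fintype.card_pos),
    ENNReal.ofReal_natCast, ENNReal.ofReal_natCast, Fintype.card_subtype]

variable {V : Type*} [Fintype V] {G : SimpleGraph V} [DecidableRel G.Adj]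

lemma effDegree_init_le (v : V) : effDegree G (fun _ => 1 / 2) v ≤ (G.maxDegree : ℝ) / 2 := by
  have h : ∀ inst : DecidablePred (G.Adj v),
      ((Finset.univ.filter (G.Adj v)).card : ℝ) ≤ G.maxDegree := by
    intro inst
    refine Nat.cast_le.2 (le_trans (le_of_eq ?_) (G.degree_le_maxDegree v))
    rw [← SimpleGraph.card_neighborFinset_eq_degree, SimpleGraph.neighborFinset_eq_filter]
    congr!
  rw [effDegree, Finset.sum_const, nsmul_eq_mul]
  push_cast
  linarith [h fun _ => Classical.propDecidable _]

variable [DecidableEq V]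

/-- Node `v` has terminated after the last round and does not collide with a neighbor, with
probability at least `1 - ε`. -/
lemma le_prob_good {ε : ℝ} (h0 : 0 < ε) (h1 : ε < 1) {f fack : ℕ} (hf : 1 ≤ f) {v : V}
    {adv : Coins V (intervalLength ε) (numRounds G.maxDegree ε) →
      Coins V (intervalLength ε) (numRounds G.maxDegree ε)}
    {exec : Coins V (intervalLength ε) (numRounds G.maxDegree ε) → Trace V Message}
    (hadv : IsAdversary G v adv) (hexec : ∀ ω, IsExecution G f fack (adv ω) (exec ω)) {T : ℝ}
    (hT : ((numRounds G.maxDegree ε * (2 * intervalLength ε + 1) : ℕ) : ℝ) * f ≤ T) :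
    ENNReal.ofReal (1 - ε) ≤ (PMF.uniformOfFintype
      (Coins V (intervalLength ε) (numRounds G.maxDegree ε))).toOuterMeasure
        (goodEvent G f adv exec v T) := by
  have hI := longInterval h0 h1
  rw [toOuterMeasure_eq_prob]
  refine ENNReal.ofReal_le_ofReal ?_
  have h2 := (prob_active_le hadv hI).trans (decay_le h0 h1 G.maxDegree
    (Finset.sum_nonneg fun u _ => by norm_num) (effDegree_init_le (G := G) v))
  have h3 := (prob_exists_collision_le hadv hI).trans (one_div_choose_le h0 h1)
  have h4 := prob_or_le (fun ω => (roundState G (adv ω) (numRounds G.maxDegree ε) v).terminated =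
    false) fun ω => ∃ t, Collision G (fun w => adv ω w t) (weights (roundState G (adv ω) t)) v
  have h5 := prob_not fun ω => (roundState G (adv ω) (numRounds G.maxDegree ε) v).terminated =
    false ∨ ∃ t, Collision G (fun w => adv ω w t) (weights (roundState G (adv ω) t)) v
  refine le_trans (by linarith) (h5.symm.trans_le (prob_mono fun ω hω => ?_))
  rw [not_or, Bool.not_eq_false] at hω
  refine ⟨⟨numRounds G.maxDegree ε * (2 * intervalLength ε + 1) * f, ?_, ?_⟩, ?_⟩
  · rw [Nat.cast_mul]
    exact hT
  · rw [(hexec ω).terminatedAt_iff hf, Nat.mul_div_cancel _ hf]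
    exact hω.1
  · exact (hexec ω).locallyCorrect hf fun u n hadj hsim =>
      hω.2 (hsim.exists_collision hI.1 hadj)

end Conclusion

end BeepMIS

theorem theorem5 :
    ∃ K : ℝ, 0 < K ∧
      ∀ (V : Type*) [Fintype V] [DecidableEq V] (G : SimpleGraph V) [DecidableRel G.Adj]
        (ε : ℝ) (_ : 0 < ε) (_ : ε < 1) (fprog fack : ℕ) (_ : 1 ≤ fprog) (v : V)
        (adv : BeepMIS.Coins V (BeepMIS.intervalLength ε) (BeepMIS.numRounds G.maxDegree ε) →
          BeepMIS.Coins V (BeepMIS.intervalLength ε) (BeepMIS.numRounds G.maxDegree ε))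
        (exec : BeepMIS.Coins V (BeepMIS.intervalLength ε) (BeepMIS.numRounds G.maxDegree ε) →
          BeepMIS.Trace V BeepMIS.Message),
        BeepMIS.IsAdversary G v adv →
        (∀ ω, BeepMIS.IsExecution G fprog fack (adv ω) (exec ω)) →
        -- a node that has terminated has made its decision
        (∀ ω τ, BeepMIS.TerminatedAt fprog (adv ω) (exec ω) v τ →
          ∃ d, BeepMIS.outputAt fprog (adv ω) (exec ω) v τ = some d) ∧
        -- the decision is locally correct, unless two neighbors output `IN` simultaneously
        (∀ ω, BeepMIS.LocallyCorrect G (BeepMIS.outputAt fprog (adv ω) (exec ω)) v ∨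
          ∃ u τ, G.Adj v u ∧
            BeepMIS.MakesOutput (BeepMIS.outputAt fprog (adv ω) (exec ω)) v .IN τ ∧
            BeepMIS.MakesOutput (BeepMIS.outputAt fprog (adv ω) (exec ω)) u .IN τ) ∧
        -- termination in time with a locally correct decision
        ENNReal.ofReal (1 - ε) ≤
          (PMF.uniformOfFintype
            (BeepMIS.Coins V (BeepMIS.intervalLength ε)
              (BeepMIS.numRounds G.maxDegree ε))).toOuterMeasure
            (BeepMIS.goodEvent G fprog adv exec v
              (K * ((BeepMIS.lg G.maxDegree + Real.logb 2 (2 / ε)) * Real.logb 2 (2 / ε) *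
                fprog))) ∧
        (ε ≤ 1 / 2 →
          ENNReal.ofReal (1 - ε) ≤
            (PMF.uniformOfFintype
              (BeepMIS.Coins V (BeepMIS.intervalLength ε)
                (BeepMIS.numRounds G.maxDegree ε))).toOuterMeasure
              (BeepMIS.goodEvent G fprog adv exec v
                (K * ((BeepMIS.lg G.maxDegree + Real.logb 2 (1 / ε)) * Real.logb 2 (1 / ε) *
                  fprog)))) := by
  refine ⟨40000000000, by norm_num, ?_⟩
  intro V _ _ G _ ε h0 h1 f fack hf v adv exec hadv hexec
  have hslots := BeepMIS.numRounds_mul_le h0 h1 G.maxDegree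
  have hL := BeepMIS.one_le_logb_two_div h0 h1
  have hlg := BeepMIS.lg_nonneg G.maxDegree
  refine ⟨fun ω τ h => ?_, fun ω => ?_, ?_, fun hε => ?_⟩
  · rw [(hexec ω).terminatedAt_iff hf] at h
    rw [(hexec ω).outputAt_eq hf]
    exact Option.ne_none_iff_exists'.1 ((BeepMIS.consistent_run _ _).decided h)
  · by_cases hsim : ∀ u n, G.Adj v u → ¬ BeepMIS.Simultaneous G (adv ω) v u n
    · exact .inl ((hexec ω).locallyCorrect hf hsim)
    · push Not at hsim
      obtain ⟨u, n, hadj, hv0, hv1, hu0, hu1⟩ := hsim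
      exact .inr ⟨u, (n + 1) * f, hadj, BeepMIS.makesOutput_of_slot (hexec ω) hf hv0 hv1,
        BeepMIS.makesOutput_of_slot (hexec ω) hf hu0 hu1⟩
  · refine BeepMIS.le_prob_good h0 h1 hf hadv hexec ?_
    rw [← mul_assoc]
    refine mul_le_mul_of_nonneg_right (hslots.trans ?_) (Nat.cast_nonneg f)
    exact mul_le_mul_of_nonneg_right (by norm_num) (by positivity)
  · refine BeepMIS.le_prob_good h0 h1 hf hadv hexec ?_
    rw [← mul_assoc]
    refine mul_le_mul_of_nonneg_right (hslots.trans ?_) (Nat.cast_nonneg f)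
    -- passing from `2 / ε` to `1 / ε` at most doubles the logarithm
    have hsum : Real.logb 2 (2 / ε) = 1 + Real.logb 2 (1 / ε) := by
      rw [show 2 / ε = 2 * (1 / ε) by ring, Real.logb_mul (by norm_num) (by positivity),
        Real.logb_self_eq_one (by norm_num)]
    have hone : 1 ≤ Real.logb 2 (1 / ε) := by
      rw [Real.le_logb_iff_rpow_le (by norm_num) (by positivity), Real.rpow_one, le_div_iff₀ h0]
      linarith
    rw [hsum]
    nlinarith [mul_nonneg hlg (sub_nonneg.2 hone)]
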